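/- Generalized stochastic blockmodel. Let $n$ nodes be given, let $r\ge 1$, and let $C_1,\dots,C_r$ be disjoint sets of nodes (the true clusters), each having at least $K\ge 1$ nodes; nodes in no cluster are called outliers. Let $0\le q<p\le 1$. A random graph on the $n$ nodes is generated by including every pair $\{i,j\}$ of distinct nodes as an edge independently; the probability of the edge is at least $p$ if $i,j$ lie in the same true cluster, and at most $q$ otherwise (that is, if they lie in different clusters or at least one of them is an outlier); apart from these bounds the edge probabilities are arbitrary. Let $A=(a_{ij})\in\{0,1\}^{n\times n}$ be the adjacency matrix of the graph, with the convention $a_{ii}=1$ for all $i$. Let $Y^*\in\{0,1\}^{n\times n}$ be the true cluster matrix: $y^*_{ij}=1$ if and only if $i$ and $j$ lie in the same true cluster (so $y^*_{ii}=1$ if $i$ lies in a cluster, and $y^*_{ii}=0$ if $i$ is an outlier). For $t\in(0,1)$ consider the convex program $$\max_{Y\in\mathbb R^{n\times n}}\ \sqrt{\tfrac{1-t}{t}}\sum_{(i,j):\,a_{ij}=1}y_{ij}-\sqrt{\tfrac{t}{1-t}}\sum_{(i,j):\,a_{ij}=0}y_{ij}-48\sqrt n\,\|Y\|_*\quad\text{subject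 to } 0\le y_{ij}\le 1\ \text{for all } i,j,$$ where $\|Y\|_*$ is the nuclear norm (the sum of the singular values) of $Y$. Theorem. There are absolute constants $c_0,c_1>0$ such that the following holds for all $n,r,K,p,q$, all true clusters and all edge probabilities as above. If $t$ satisfies $\frac14p+\frac34q\le t\le\frac34p+\frac14q$ and $$\frac{p-q}{\sqrt{p(1-q)}}\ \ge\ c_1\max\left\{\frac{\sqrt n}{K},\ \frac{\log^2 n}{\sqrt K}\right\},$$ then with probability at least $1-c_0n^{-8}$ the matrix $Y^*$ is the unique optimal solution of the convex program. -/

import Mathlib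

open MeasureTheory ProbabilityTheory
open scoped BigOperators

noncomputable section

/-- Two nodes lie in a common cluster of the family `C`. (Nodes belonging to no `C k` are the
outliers; an outlier lies in a common cluster with no node, not even itself.) -/
def SameCluster {n r : ℕ} (C : Fin r → Finset (Fin n)) (i j : Fin n) : Prop :=
  ∃ k, i ∈ C k ∧ j ∈ C k

/-- The generalized stochastic blockmodel (homophily case) on the nodes `Fin n`, with true clusters
`C 0, …, C (r - 1)`, where `G` is a random graph on the probability space `(Ω, μ)`. -/
structure IsGSBM {Ω : Type*} [MeasurableSpace Ω] (μ : Measure Ω) {n r : ℕ}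
    (C : Fin r → Finset (Fin n)) (K : ℕ) (p q : ℝ) (G : Ω → SimpleGraph (Fin n)) : Prop where
  /-- There is at least one true cluster. -/
  one_le_r : 1 ≤ r
  /-- The true clusters are disjoint. -/
  disjoint : Pairwise (Function.onFun Disjoint C)
  /-- The true clusters are nonempty, with at least `K` nodes each. -/
  K_pos : 1 ≤ K
  K_le : ∀ k, K ≤ (C k).card
  /-- Edges are events. -/
  measurable : ∀ i j, MeasurableSet {ω | (G ω).Adj i j}
  /-- The edges (unordered pairs of distinct nodes) are drawn independently. -/
  indep : iIndepSet
    (fun e : {e : Fin n × Fin n // e.1 < e.2} => {ω | (G ω).Adj e.1.1 e.1.2}) μ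
  /-- In-cluster pairs are joined with probability at least `p`. -/
  le_prob : ∀ i j, i ≠ j → SameCluster C i j → p ≤ μ.real {ω | (G ω).Adj i j}
  /-- All other pairs, including those with an outlier, are joined with probability at most `q`. -/
  prob_le : ∀ i j, i ≠ j → ¬ SameCluster C i j → μ.real {ω | (G ω).Adj i j} ≤ q

open Classical in
/-- The true cluster matrix `Y*`. -/
def clusterMatrix {n r : ℕ} (C : Fin r → Finset (Fin n)) : Matrix (Fin n) (Fin n) ℝ :=
  Matrix.of fun i j => if SameCluster C i j then 1 else 0

open Classical in
/-- The adjacency matrix, with the convention that all diagonal entries are `1`. -/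
def adjacencyMatrix {n : ℕ} (G : SimpleGraph (Fin n)) : Matrix (Fin n) (Fin n) ℝ :=
  Matrix.of fun i j => if i = j ∨ G.Adj i j then 1 else 0

/-- The nuclear norm: the sum of the singular values. -/
def nuclearNorm {n : ℕ} (Y : Matrix (Fin n) (Fin n) ℝ) : ℝ :=
  ∑ k : Fin n, (Matrix.toEuclideanLin Y).singularValues k

open Classical in
/-- The objective of the convex program with data matrix `A` and parameter `t`. -/
def objective {n : ℕ} (A : Matrix (Fin n) (Fin n) ℝ) (t : ℝ) (Y : Matrix (Fin n) (Fin n) ℝ) : ℝ :=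
  √((1 - t) / t) * (∑ e : Fin n × Fin n with A e.1 e.2 = 1, Y e.1 e.2)
    - √(t / (1 - t)) * (∑ e : Fin n × Fin n with A e.1 e.2 = 0, Y e.1 e.2)
    - 48 * √(n : ℝ) * nuclearNorm Y

/-- The feasible set of the convex program. -/
def feasibleSet (n : ℕ) : Set (Matrix (Fin n) (Fin n) ℝ) :=
  {Y | ∀ i j, 0 ≤ Y i j ∧ Y i j ≤ 1}

/-- `Y` is the unique optimal solution of the (maximization) convex program. -/
def IsUniqueOptimum {n : ℕ} (A : Matrix (Fin n) (Fin n) ℝ) (t : ℝ)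
    (Y : Matrix (Fin n) (Fin n) ℝ) : Prop :=
  Y ∈ feasibleSet n ∧ ∀ Z ∈ feasibleSet n, Z ≠ Y → objective A t Z < objective A t Y

end

/-!
The proof exhibits a dual certificate for the cluster matrix `Y*`.

**Reduction to the extremal model.** Generate the graph from one uniform variable per pair by
thresholding (`IsGSBM.measureReal_eq`). Inside the clusters the edge indicator dominates the one
with probability exactly `p`, elsewhere it is dominated by the one with probability exactly `q`,
and `Y*` is extremal in the box in these two directions. So only the noise `N` of the model with
probabilities `p` and `q` matters; after scaling by `1 / √(t (1 - t))` its variances are at most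
`4`.

**Certificate.** Let `P` be the projection onto the cluster indicators and `Q = 1 - P`. The matrix
`P + Q S Q` with `48 √n S = N + (diagonal of the outliers)` is a subgradient of the nuclear norm
at `Y*` as soon as `‖N‖ ≤ 40 √n`. Subtracting it from the weights leaves the mean, which has the
right signs with margin `δ = (p - q) / (4 √(t (1 - t)))`, the term `48 √n P` of size
`48 √n / K ≤ δ / 4`, and `P N + N P - P N P`, whose entries are controlled by the cluster averages of `N`
(`isUniqueOptimum_of_noise_bounds`). The cluster averages are handled by Chernoff's bound
(`IsNoise.measureReal_sum_ge_le`).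

**Spectral norm.** The bound `‖N‖ ≤ 40 √n` has to hold for entries as large as `√n / log ^ 2 n`,
where matrix concentration loses a logarithm. It comes from the trace of `N ^ (2 k)` with `k` of
order `log n`. Only closed walks using no edge exactly once contribute, each with a weight that
depends on its number of vertices. Such walks need not be enumerated: pairing walks of equal shape
on `n` and on `8 k` vertices (`sum_repetitive_le`) reduces the sum to the number of such walks on
`8 k` vertices. That number is at most the trace moment of any random symmetric matrix of order
`8 k` with independent entries whose moments are `0` in degree one and at least `1` in the other
degrees (`card_repetitive_le`). The centred law on the two roots of `x ^ 2 = x + 1` is bounded and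
has this property, its moments being Fibonacci numbers. For it, the trace moment is bounded by
averaging the subgaussian quadratic form over a ball, where it is large near a top eigenvector
(`goldenExp_trace_pow_le`).
-/

/-! ### Traces, spectra and the nuclear norm -/

section LinearAlgebra

open Matrix

lemma trace_toEuclideanLin {ι : Type*} [Fintype ι] [DecidableEq ι] (M : Matrix ι ι ℝ) :
    LinearMap.trace ℝ _ (toEuclideanLin M) = M.trace := by
  rw [LinearMap.trace_eq_sum_inner _ (EuclideanSpace.basisFun ι ℝ)]
  simp [Matrix.trace, toLpLin_apply, EuclideanSpace.inner_single_left]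

lemma inner_toEuclideanLin_transpose {ι : Type*} [Fintype ι] [DecidableEq ι] (M : Matrix ι ι ℝ)
    (x y : EuclideanSpace ℝ ι) :
    inner ℝ x (toEuclideanLin Mᵀ y) = inner ℝ (toEuclideanLin M x) y := by
  have h := Matrix.toEuclideanLin_conjTranspose_eq_adjoint M
  rw [conjTranspose_eq_transpose_of_trivial] at h
  rw [h, LinearMap.adjoint_inner_right]

lemma sum_mul_eq_sum_inner {ι κ : Type*} [Fintype ι] [DecidableEq ι] [Fintype κ]
    (M Z : Matrix ι ι ℝ) (b : OrthonormalBasis κ ℝ (EuclideanSpace ℝ ι)) :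
    ∑ i, ∑ j, M i j * Z i j = ∑ k, inner ℝ (toEuclideanLin M (b k)) (toEuclideanLin Z (b k)) := by
  have h1 : ∑ i, ∑ j, M i j * Z i j = (Mᵀ * Z).trace := by
    simp only [Matrix.trace, Matrix.diag, Matrix.mul_apply, Matrix.transpose_apply]
    rw [Finset.sum_comm]
  rw [h1, ← trace_toEuclideanLin, LinearMap.trace_eq_sum_inner _ b]
  refine Finset.sum_congr rfl fun k _ => ?_
  rw [← inner_toEuclideanLin_transpose, toLpLin_mul_same]
  rfl

/-- The singular values are the lengths of the images of an orthonormal basis of right singular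
vectors. -/
lemma norm_apply_eq_singularValues {n : ℕ}
    (T : EuclideanSpace ℝ (Fin n) →ₗ[ℝ] EuclideanSpace ℝ (Fin n)) (k : Fin n) :
    ‖T (T.isSymmetric_adjoint_comp_self.eigenvectorBasis finrank_euclideanSpace_fin k)‖
      = T.singularValues k := by
  set v := T.isSymmetric_adjoint_comp_self.eigenvectorBasis finrank_euclideanSpace_fin with hv
  have h : ‖T (v k)‖ ^ 2 = T.singularValues k ^ 2 := by
    rw [T.sq_singularValues_fin finrank_euclideanSpace_fin, ← real_inner_self_eq_norm_sq,
      ← LinearMap.adjoint_inner_right]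
    have := T.isSymmetric_adjoint_comp_self.apply_eigenvectorBasis finrank_euclideanSpace_fin k
    rw [LinearMap.comp_apply] at this
    rw [hv, this, inner_smul_right, real_inner_self_eq_norm_sq]
    simp
  exact (sq_eq_sq₀ (norm_nonneg _) (T.singularValues_nonneg _)).1 h

/-- Duality of the nuclear norm and the spectral norm. -/
lemma sum_mul_le_nuclearNorm {n : ℕ} (M Z : Matrix (Fin n) (Fin n) ℝ)
    (hM : ∀ x, ‖toEuclideanLin M x‖ ≤ ‖x‖) :
    ∑ i, ∑ j, M i j * Z i j ≤ nuclearNorm Z := by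
  set T := toEuclideanLin Z with hT
  rw [sum_mul_eq_sum_inner M Z
    (T.isSymmetric_adjoint_comp_self.eigenvectorBasis finrank_euclideanSpace_fin), nuclearNorm]
  refine Finset.sum_le_sum fun k _ => ?_
  rw [← hT, ← norm_apply_eq_singularValues]
  refine (real_inner_le_norm _ _).trans ?_
  refine (mul_le_mul_of_nonneg_right (hM _) (norm_nonneg _)).trans ?_
  simp

/-- A right singular vector `v` of a positive semidefinite `Y` with singular value `s` satisfies
`Y v = s v`, because `Y` has no negative eigenvalue. -/
lemma nuclearNorm_eq_trace {n : ℕ} {Y : Matrix (Fin n) (Fin n) ℝ} (hY : Y.PosSemidef) :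
    nuclearNorm Y = Y.trace := by
  set T := toEuclideanLin Y with hT
  have hself : T.adjoint = T := by
    rw [hT, ← Matrix.toEuclideanLin_conjTranspose_eq_adjoint, hY.isHermitian.eq]
  have hpos : ∀ x, 0 ≤ inner ℝ x (T x) := fun x => by
    have := hY.dotProduct_mulVec_nonneg (x : Fin n → ℝ)
    simpa [hT, toLpLin_apply, EuclideanSpace.inner_eq_star_dotProduct, dotProduct_comm] using this
  rw [← trace_toEuclideanLin, LinearMap.trace_eq_sum_inner _
    (T.isSymmetric_adjoint_comp_self.eigenvectorBasis finrank_euclideanSpace_fin), nuclearNorm]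
  refine Finset.sum_congr rfl fun k _ => ?_
  rw [← hT]
  set v := T.isSymmetric_adjoint_comp_self.eigenvectorBasis finrank_euclideanSpace_fin k with hv
  set s := T.singularValues k with hs
  have hs0 : 0 ≤ s := T.singularValues_nonneg _
  have hnorm : ‖T v‖ = s := norm_apply_eq_singularValues T k
  have hv1 : ‖v‖ = 1 := by simp [hv]
  have hTT : T (T v) = s ^ 2 • v := by
    have := T.isSymmetric_adjoint_comp_self.apply_eigenvectorBasis finrank_euclideanSpace_fin k
    rw [LinearMap.comp_apply, ← T.sq_singularValues_fin finrank_euclideanSpace_fin] at this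
    rw [← hv, ← hs] at this
    exact (congrArg (fun S : EuclideanSpace ℝ (Fin n) →ₗ[ℝ] _ => S (T v)) hself).symm.trans this
  have hsymm : ∀ x y, inner ℝ (T x) y = inner ℝ x (T y) := fun x y => by
    rw [← LinearMap.adjoint_inner_right, hself]
  -- `u = T v - s v` satisfies `T u = - s u`
  have hu := hpos (T v - s • v)
  have h1 : inner ℝ (T v) (T v) = s ^ 2 := by rw [real_inner_self_eq_norm_sq, hnorm]
  have h2 : inner ℝ v v = (1 : ℝ) := by rw [real_inner_self_eq_norm_sq, hv1]; norm_num
  rw [map_sub, map_smul, hTT] at hu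
  simp only [inner_sub_left, inner_sub_right, inner_smul_left, inner_smul_right,
    conj_trivial, h1, h2, hsymm] at hu
  have hup : inner ℝ v (T v) ≤ s := by
    calc inner ℝ v (T v) ≤ ‖v‖ * ‖T v‖ := real_inner_le_norm _ _
      _ = s := by rw [hv1, hnorm, one_mul]
  rcases hs0.eq_or_lt with h0 | h0
  · have := hpos v
    linarith
  · have : s ≤ inner ℝ v (T v) := by
      by_contra! hlt
      nlinarith [mul_pos h0 h0, mul_pos (mul_pos h0 h0) (sub_pos.2 hlt)]
    linarith

lemma IsHermitian.trace_pow_eq_sum_eigenvalues_pow {ι : Type*} [Fintype ι] [DecidableEq ι]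
    {A : Matrix ι ι ℝ} (hA : A.IsHermitian) (m : ℕ) :
    (A ^ m).trace = ∑ i, hA.eigenvalues i ^ m := by
  have happ : ∀ (m : ℕ) (i), (A ^ m) *ᵥ ⇑(hA.eigenvectorBasis i) =
      hA.eigenvalues i ^ m • ⇑(hA.eigenvectorBasis i) := by
    intro m i
    induction m with
    | zero => simp
    | succ m ih => rw [pow_succ, ← mulVec_mulVec, hA.mulVec_eigenvectorBasis, mulVec_smul, ih,
        smul_smul, pow_succ, mul_comm]
  rw [← trace_toEuclideanLin, LinearMap.trace_eq_sum_inner _ hA.eigenvectorBasis]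
  refine Finset.sum_congr rfl fun i _ => ?_
  have : toEuclideanLin (A ^ m) (hA.eigenvectorBasis i) =
      hA.eigenvalues i ^ m • hA.eigenvectorBasis i := by
    rw [toLpLin_apply, happ]; rfl
  rw [this, inner_smul_right, real_inner_self_eq_norm_sq]
  simp

lemma IsHermitian.norm_apply_le_of_abs_eigenvalues_le {ι : Type*} [Fintype ι] [DecidableEq ι]
    {A : Matrix ι ι ℝ} (hA : A.IsHermitian) {τ : ℝ} (hτ : 0 ≤ τ)
    (h : ∀ i, |hA.eigenvalues i| ≤ τ) (x : EuclideanSpace ℝ ι) :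
    ‖toEuclideanLin A x‖ ≤ τ * ‖x‖ := by
  have hb : ∀ i, inner ℝ (hA.eigenvectorBasis i) (toEuclideanLin A x) =
      hA.eigenvalues i * inner ℝ (hA.eigenvectorBasis i) x := fun i => by
    have h2 : A = Aᵀ := by
      rw [← conjTranspose_eq_transpose_of_trivial, hA.eq]
    have h3 : inner ℝ (hA.eigenvectorBasis i) (toEuclideanLin A x) =
        inner ℝ (toEuclideanLin A (hA.eigenvectorBasis i)) x :=
      (congrArg (fun B => inner ℝ (hA.eigenvectorBasis i) (toEuclideanLin B x)) h2).trans
        (inner_toEuclideanLin_transpose A _ _)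
    rw [h3]
    have : toEuclideanLin A (hA.eigenvectorBasis i) =
        hA.eigenvalues i • hA.eigenvectorBasis i := by
      rw [toLpLin_apply, hA.mulVec_eigenvectorBasis]; rfl
    rw [this, inner_smul_left]; simp
  have hsq : ‖toEuclideanLin A x‖ ^ 2 ≤ (τ * ‖x‖) ^ 2 := by
    rw [mul_pow, ← hA.eigenvectorBasis.sum_sq_norm_inner_right,
      ← hA.eigenvectorBasis.sum_sq_norm_inner_right x, Finset.mul_sum]
    refine Finset.sum_le_sum fun i _ => ?_
    rw [hb, norm_mul, mul_pow]
    refine mul_le_mul_of_nonneg_right ?_ (by positivity)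
    rw [Real.norm_eq_abs]
    exact pow_le_pow_left₀ (abs_nonneg _) (h i) 2
  exact (sq_le_sq₀ (norm_nonneg _) (by positivity)).1 hsq

/-- An even spectral moment below `τ ^ (2 k)` forces the spectral norm below `τ`. -/
lemma IsHermitian.norm_apply_le_of_trace_pow_le {ι : Type*} [Fintype ι] [DecidableEq ι]
    {A : Matrix ι ι ℝ} (hA : A.IsHermitian) {τ : ℝ} (hτ : 0 ≤ τ) {k : ℕ} (hk : k ≠ 0)
    (h : (A ^ (2 * k)).trace ≤ τ ^ (2 * k)) (x : EuclideanSpace ℝ ι) :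
    ‖toEuclideanLin A x‖ ≤ τ * ‖x‖ := by
  refine IsHermitian.norm_apply_le_of_abs_eigenvalues_le hA hτ (fun i => ?_) x
  rw [IsHermitian.trace_pow_eq_sum_eigenvalues_pow hA] at h
  have h1 : hA.eigenvalues i ^ (2 * k) ≤ τ ^ (2 * k) :=
    (Finset.single_le_sum (f := fun i => hA.eigenvalues i ^ (2 * k))
      (fun j _ => (even_two_mul k).pow_nonneg _) (Finset.mem_univ i)).trans h
  rw [← (even_two_mul k).pow_abs] at h1
  exact (pow_le_pow_iff_left₀ (abs_nonneg _) hτ (by omega)).1 h1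

end LinearAlgebra

/-! ### The dual certificate -/

section DualCertificate

open Matrix

variable {n r : ℕ} {C : Fin r → Finset (Fin n)}

lemma SameCluster.symm {i j : Fin n} (h : SameCluster C i j) : SameCluster C j i := by
  obtain ⟨k, hi, hj⟩ := h
  exact ⟨k, hj, hi⟩

lemma SameCluster.left {i j : Fin n} (h : SameCluster C i j) : SameCluster C i i := by
  obtain ⟨k, hi, -⟩ := h
  exact ⟨k, hi, hi⟩

lemma SameCluster.trans (hC : Pairwise (Function.onFun Disjoint C)) {i j l : Fin n}
    (h : SameCluster C i j) (h' : SameCluster C j l) : SameCluster C i l := by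
  obtain ⟨k, hi, hj⟩ := h
  obtain ⟨k', hj', hl⟩ := h'
  have : k = k' := by
    by_contra hne
    exact Finset.disjoint_left.1 (hC hne) hj hj'
  subst this
  exact ⟨k, hi, hl⟩

open Classical in
/-- The cluster of the node `i`; it is empty when `i` is an outlier. -/
noncomputable def clusterOf (C : Fin r → Finset (Fin n)) (i : Fin n) : Finset (Fin n) :=
  Finset.univ.filter (SameCluster C i)

lemma mem_clusterOf {i j : Fin n} : j ∈ clusterOf C i ↔ SameCluster C i j := by
  simp [clusterOf]

lemma clusterOf_eq (hC : Pairwise (Function.onFun Disjoint C)) {i j : Fin n}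
    (h : SameCluster C i j) : clusterOf C i = clusterOf C j := by
  ext l
  rw [mem_clusterOf, mem_clusterOf]
  exact ⟨fun h' => h.symm.trans hC h', fun h' => h.trans hC h'⟩

lemma le_card_clusterOf {K : ℕ} (hK : ∀ k, K ≤ (C k).card) {i j : Fin n}
    (h : SameCluster C i j) : K ≤ (clusterOf C i).card := by
  obtain ⟨k, hi, -⟩ := h
  refine (hK k).trans (Finset.card_le_card fun l hl => ?_)
  exact mem_clusterOf.2 ⟨k, hi, hl⟩

lemma card_clusterOf_pos {i j : Fin n} (h : SameCluster C i j) :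
    (0 : ℝ) < (clusterOf C i).card := by
  exact_mod_cast Finset.card_pos.2 ⟨j, mem_clusterOf.2 h⟩

open Classical in
/-- The orthogonal projection onto the span of the cluster indicators: it averages over clusters. -/
noncomputable def clusterProj (C : Fin r → Finset (Fin n)) : Matrix (Fin n) (Fin n) ℝ :=
  Matrix.of fun i j => if SameCluster C i j then ((clusterOf C i).card : ℝ)⁻¹ else 0

lemma clusterProj_of_same {i j : Fin n} (h : SameCluster C i j) :
    clusterProj C i j = ((clusterOf C i).card : ℝ)⁻¹ := by simp [clusterProj, h]

lemma clusterProj_of_not_same {i j : Fin n} (h : ¬ SameCluster C i j) :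
    clusterProj C i j = 0 := by simp [clusterProj, h]

lemma clusterMatrix_of_same {i j : Fin n} (h : SameCluster C i j) :
    clusterMatrix C i j = 1 := by simp [clusterMatrix, h]

lemma clusterMatrix_of_not_same {i j : Fin n} (h : ¬ SameCluster C i j) :
    clusterMatrix C i j = 0 := by simp [clusterMatrix, h]

lemma clusterProj_nonneg (i j : Fin n) : 0 ≤ clusterProj C i j := by
  by_cases h : SameCluster C i j
  · rw [clusterProj_of_same h]; positivity
  · rw [clusterProj_of_not_same h]

lemma clusterProj_mul_apply (M : Matrix (Fin n) (Fin n) ℝ) (i j : Fin n) :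
    (clusterProj C * M) i j = ((clusterOf C i).card : ℝ)⁻¹ * ∑ l ∈ clusterOf C i, M l j := by
  classical
  rw [mul_apply, clusterOf, Finset.sum_filter, Finset.mul_sum]
  refine Finset.sum_congr rfl fun l _ => ?_
  by_cases h : SameCluster C i l
  · rw [clusterProj_of_same h, if_pos h]; rfl
  · rw [clusterProj_of_not_same h, if_neg h]; simp

lemma clusterProj_transpose (hC : Pairwise (Function.onFun Disjoint C)) :
    (clusterProj C)ᵀ = clusterProj C := by
  ext i j
  rw [transpose_apply]
  by_cases h : SameCluster C i j
  · rw [clusterProj_of_same h, clusterProj_of_same h.symm, clusterOf_eq hC h]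
  · rw [clusterProj_of_not_same h, clusterProj_of_not_same fun h' => h h'.symm]

lemma clusterProj_mul_self (hC : Pairwise (Function.onFun Disjoint C)) :
    clusterProj C * clusterProj C = clusterProj C := by
  ext i j
  rw [clusterProj_mul_apply]
  by_cases h : SameCluster C i j
  · have : ∀ l ∈ clusterOf C i, clusterProj C l j = ((clusterOf C i).card : ℝ)⁻¹ := fun l hl => by
      rw [mem_clusterOf] at hl
      rw [clusterProj_of_same (hl.symm.trans hC h), clusterOf_eq hC hl]
    rw [Finset.sum_congr rfl this, Finset.sum_const, nsmul_eq_mul, clusterProj_of_same h,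
      mul_inv_cancel₀ (card_clusterOf_pos h).ne', mul_one]
  · rw [clusterProj_of_not_same h, Finset.sum_eq_zero, mul_zero]
    intro l hl
    rw [mem_clusterOf] at hl
    exact clusterProj_of_not_same fun h' => h (hl.trans hC h')

lemma clusterProj_mul_clusterMatrix (hC : Pairwise (Function.onFun Disjoint C)) :
    clusterProj C * clusterMatrix C = clusterMatrix C := by
  ext i j
  rw [clusterProj_mul_apply]
  by_cases h : SameCluster C i j
  · have : ∀ l ∈ clusterOf C i, clusterMatrix C l j = 1 := fun l hl => by
      rw [mem_clusterOf] at hl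
      exact clusterMatrix_of_same (hl.symm.trans hC h)
    rw [Finset.sum_congr rfl this, Finset.sum_const, nsmul_eq_mul, clusterMatrix_of_same h, mul_one,
      inv_mul_cancel₀ (card_clusterOf_pos h).ne']
  · rw [clusterMatrix_of_not_same h, Finset.sum_eq_zero, mul_zero]
    intro l hl
    rw [mem_clusterOf] at hl
    exact clusterMatrix_of_not_same fun h' => h (hl.trans hC h')

lemma sum_clusterProj_le_one (hC : Pairwise (Function.onFun Disjoint C)) (j : Fin n) :
    ∑ l, clusterProj C l j ≤ 1 := by
  classical
  have h : ∑ l, clusterProj C l j = ∑ l, clusterProj C j l :=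
    Finset.sum_congr rfl fun l _ => by
      conv_lhs => rw [← clusterProj_transpose hC, transpose_apply]
  rw [h]
  have h2 : ∑ l, clusterProj C j l = ∑ l ∈ clusterOf C j, ((clusterOf C j).card : ℝ)⁻¹ := by
    rw [clusterOf, Finset.sum_filter]
    exact Finset.sum_congr rfl fun l _ => rfl
  rw [h2, Finset.sum_const, nsmul_eq_mul]
  exact mul_inv_le_one

lemma clusterMatrix_posSemidef (hC : Pairwise (Function.onFun Disjoint C)) :
    (clusterMatrix C).PosSemidef := by
  have h : clusterMatrix C = (clusterProj C)ᴴ *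
      diagonal (fun i => ((clusterOf C i).card : ℝ)) * clusterProj C := by
    rw [conjTranspose_eq_transpose_of_trivial, clusterProj_transpose hC, Matrix.mul_assoc]
    conv_lhs => rw [← clusterProj_mul_clusterMatrix hC]
    congr 1
    ext i j
    rw [diagonal_mul]
    by_cases h : SameCluster C i j
    · rw [clusterMatrix_of_same h, clusterProj_of_same h,
        mul_inv_cancel₀ (card_clusterOf_pos h).ne']
    · rw [clusterMatrix_of_not_same h, clusterProj_of_not_same h, mul_zero]
  rw [h]
  exact (PosSemidef.diagonal fun i => by positivity).conjTranspose_mul_mul_same _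

lemma sum_clusterProj_mul_clusterMatrix (hC : Pairwise (Function.onFun Disjoint C)) :
    ∑ i, ∑ j, clusterProj C i j * clusterMatrix C i j = nuclearNorm (clusterMatrix C) := by
  rw [nuclearNorm_eq_trace (clusterMatrix_posSemidef hC)]
  conv_rhs => rw [← clusterProj_mul_clusterMatrix hC]
  rw [Matrix.trace]
  refine Finset.sum_congr rfl fun i _ => ?_
  rw [diag_apply, mul_apply]
  refine Finset.sum_congr rfl fun j _ => ?_
  congr 1
  by_cases h : SameCluster C i j
  · rw [clusterMatrix_of_same h, clusterMatrix_of_same h.symm]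
  · rw [clusterMatrix_of_not_same h, clusterMatrix_of_not_same fun h' => h h'.symm]

/-- `P + Q S Q`, with `Q = 1 - P` the complementary projection, is a contraction if `S` is. -/
lemma norm_clusterProj_add_le (hC : Pairwise (Function.onFun Disjoint C))
    {S : Matrix (Fin n) (Fin n) ℝ} (hS : ∀ x, ‖toEuclideanLin S x‖ ≤ ‖x‖)
    (x : EuclideanSpace ℝ (Fin n)) :
    ‖toEuclideanLin (clusterProj C + (1 - clusterProj C) * S * (1 - clusterProj C)) x‖ ≤ ‖x‖ := by
  set P := toEuclideanLin (clusterProj C) with hP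
  have hPP : ∀ y, P (P y) = P y := fun y => by
    have : toEuclideanLin (clusterProj C * clusterProj C) y = P (P y) := by
      rw [toLpLin_mul_same]; rfl
    rw [← this, clusterProj_mul_self hC]
  have hsymm : ∀ y z, inner ℝ (P y) z = inner ℝ y (P z) := fun y z => by
    rw [hP, ← inner_toEuclideanLin_transpose, clusterProj_transpose hC]
  have horth : ∀ y z, inner ℝ (P y) (z - P z) = 0 := fun y z => by
    rw [hsymm, map_sub, hPP, sub_self, inner_zero_right]
  have hpyth : ∀ y z, ‖P y + (z - P z)‖ ^ 2 = ‖P y‖ ^ 2 + ‖z - P z‖ ^ 2 := fun y z => by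
    rw [norm_add_sq_real, horth]; ring
  have hle : ∀ z, ‖z - P z‖ ≤ ‖z‖ := fun z => by
    have := hpyth z z
    rw [add_sub_cancel] at this
    exact (sq_le_sq₀ (norm_nonneg _) (norm_nonneg _)).1 (by nlinarith [sq_nonneg ‖P z‖])
  have hexp : toEuclideanLin (clusterProj C + (1 - clusterProj C) * S * (1 - clusterProj C)) x =
      P x + (toEuclideanLin S (x - P x) - P (toEuclideanLin S (x - P x))) := by
    simp only [map_add, map_sub, toLpLin_mul_same, LinearMap.add_apply, LinearMap.comp_apply,
      LinearMap.sub_apply, toLpLin_one, LinearMap.id_apply, ← hP]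
    abel
  rw [hexp]
  refine (sq_le_sq₀ (norm_nonneg _) (norm_nonneg _)).1 ?_
  have h1 := hpyth x x
  rw [add_sub_cancel] at h1
  rw [hpyth, h1]
  have h2 := (hle (toEuclideanLin S (x - P x))).trans (hS _)
  nlinarith [norm_nonneg (toEuclideanLin S (x - P x) - P (toEuclideanLin S (x - P x)))]

/-- If `M` is a subgradient of the nuclear norm at the cluster matrix, and `B - lam M` is positive
within clusters and negative elsewhere, then moving from the cluster matrix to any other feasible
point strictly decreases `Y ↦ ⟪B, Y⟫ - lam ‖Y‖_*`. -/
lemma lt_of_certificate {B M : Matrix (Fin n) (Fin n) ℝ} {lam : ℝ} (hlam : 0 ≤ lam)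
    (hM : ∀ x, ‖toEuclideanLin M x‖ ≤ ‖x‖)
    (hMY : ∑ i, ∑ j, M i j * clusterMatrix C i j = nuclearNorm (clusterMatrix C))
    (hin : ∀ i j, SameCluster C i j → lam * M i j < B i j)
    (hout : ∀ i j, ¬ SameCluster C i j → B i j < lam * M i j)
    {Z : Matrix (Fin n) (Fin n) ℝ} (hZ : Z ∈ feasibleSet n) (hne : Z ≠ clusterMatrix C) :
    ∑ i, ∑ j, B i j * Z i j - lam * nuclearNorm Z <
      ∑ i, ∑ j, B i j * clusterMatrix C i j - lam * nuclearNorm (clusterMatrix C) := by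
  have h1 := mul_le_mul_of_nonneg_left (sum_mul_le_nuclearNorm M Z hM) hlam
  have hterm : ∀ i j, 0 ≤ (B i j - lam * M i j) * (clusterMatrix C i j - Z i j) := fun i j => by
    by_cases h : SameCluster C i j
    · rw [clusterMatrix_of_same h]
      exact mul_nonneg (sub_pos.2 (hin i j h)).le (sub_nonneg.2 (hZ i j).2)
    · rw [clusterMatrix_of_not_same h]
      exact mul_nonneg_of_nonpos_of_nonpos (sub_neg.2 (hout i j h)).le
        (by linarith [(hZ i j).1])
  obtain ⟨i₀, j₀, h0⟩ : ∃ i j, Z i j ≠ clusterMatrix C i j := by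
    by_contra! h
    exact hne (Matrix.ext h)
  have hpos : 0 < (B i₀ j₀ - lam * M i₀ j₀) * (clusterMatrix C i₀ j₀ - Z i₀ j₀) := by
    refine (hterm i₀ j₀).lt_of_ne' (mul_ne_zero ?_ (sub_ne_zero.2 h0.symm))
    by_cases h : SameCluster C i₀ j₀
    · exact (sub_pos.2 (hin _ _ h)).ne'
    · exact (sub_neg.2 (hout _ _ h)).ne
  have hsum : 0 < ∑ i, ∑ j, (B i j - lam * M i j) * (clusterMatrix C i j - Z i j) :=
    Finset.sum_pos' (fun i _ => Finset.sum_nonneg fun j _ => hterm i j)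
      ⟨i₀, Finset.mem_univ _, Finset.sum_pos' (fun j _ => hterm i₀ j)
        ⟨j₀, Finset.mem_univ _, hpos⟩⟩
  have hexp : ∑ i, ∑ j, (B i j - lam * M i j) * (clusterMatrix C i j - Z i j) =
      ∑ i, ∑ j, B i j * clusterMatrix C i j - ∑ i, ∑ j, B i j * Z i j -
      (lam * ∑ i, ∑ j, M i j * clusterMatrix C i j - lam * ∑ i, ∑ j, M i j * Z i j) := by
    simp only [Finset.mul_sum, ← Finset.sum_sub_distrib]
    refine Finset.sum_congr rfl fun i _ => Finset.sum_congr rfl fun j _ => ?_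
    ring
  rw [hexp, hMY] at hsum
  linarith

/-- The weight of each entry of `Y` in the linear part of the objective. -/
noncomputable def weightMatrix (A : Matrix (Fin n) (Fin n) ℝ) (t : ℝ) : Matrix (Fin n) (Fin n) ℝ :=
  Matrix.of fun i j => √((1 - t) / t) * A i j - √(t / (1 - t)) * (1 - A i j)

lemma objective_eq {A : Matrix (Fin n) (Fin n) ℝ} (hA : ∀ i j, A i j = 0 ∨ A i j = 1) (t : ℝ)
    (Y : Matrix (Fin n) (Fin n) ℝ) :
    objective A t Y =
      ∑ i, ∑ j, weightMatrix A t i j * Y i j - 48 * √(n : ℝ) * nuclearNorm Y := by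
  classical
  rw [objective, Finset.sum_filter, Finset.sum_filter, Finset.mul_sum, Finset.mul_sum,
    ← Finset.sum_sub_distrib, Fintype.sum_prod_type]
  congr 1
  refine Finset.sum_congr rfl fun i _ => Finset.sum_congr rfl fun j _ => ?_
  rcases hA i j with h | h <;> simp [weightMatrix, h]

lemma abs_sub_compress_le (hC : Pairwise (Function.onFun Disjoint C))
    {N : Matrix (Fin n) (Fin n) ℝ} (hN : Nᵀ = N) {η : ℝ}
    (h : ∀ i j, |(clusterProj C * N) i j| ≤ η) (i j : Fin n) :
    |N i j - ((1 - clusterProj C) * N * (1 - clusterProj C)) i j| ≤ 3 * η := by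
  have hη : 0 ≤ η := (abs_nonneg _).trans (h i j)
  have h1 : (N * clusterProj C) i j = (clusterProj C * N) j i := by
    rw [← transpose_apply (clusterProj C * N), transpose_mul, hN, clusterProj_transpose hC]
  have h2 : |(clusterProj C * N * clusterProj C) i j| ≤ η := by
    rw [mul_apply]
    refine (Finset.abs_sum_le_sum_abs _ _).trans ?_
    calc ∑ l, |(clusterProj C * N) i l * clusterProj C l j|
        ≤ ∑ l, η * clusterProj C l j := Finset.sum_le_sum fun l _ => by
          rw [abs_mul, abs_of_nonneg (clusterProj_nonneg l j)]
          exact mul_le_mul_of_nonneg_right (h i l) (clusterProj_nonneg l j)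
      _ = η * ∑ l, clusterProj C l j := by rw [Finset.mul_sum]
      _ ≤ η := mul_le_of_le_one_right hη (sum_clusterProj_le_one hC j)
  have h3 : N i j - ((1 - clusterProj C) * N * (1 - clusterProj C)) i j =
      (clusterProj C * N) i j + (clusterProj C * N) j i -
        (clusterProj C * N * clusterProj C) i j := by
    rw [← h1]
    have : (1 - clusterProj C) * N * (1 - clusterProj C) =
      N - clusterProj C * N - N * clusterProj C + clusterProj C * N * clusterProj C := by
      noncomm_ring
    rw [this]
    simp only [Matrix.add_apply, Matrix.sub_apply]
    ring
  rw [h3]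
  have h4 := h i j
  have h5 := h j i
  rw [abs_le] at *
  constructor <;> linarith [h2.1, h2.2, h4.1, h4.2, h5.1, h5.2]

open Classical in
/-- Deterministic recovery. The weights dominate `δ + N` within clusters, and are dominated by
`N - δ` elsewhere, up to an error `e` on the diagonal entries of the outliers. The dual certificate
is `P + W` with `48 √n W = Q N Q + e 1_outliers`; the projection `P` annihilates the last term. -/
theorem isUniqueOptimum_of_noise_bounds (hC : Pairwise (Function.onFun Disjoint C))
    {K : ℕ} (hK1 : 1 ≤ K) (hK : ∀ k, K ≤ (C k).card)
    {A : Matrix (Fin n) (Fin n) ℝ} (hA : ∀ i j, A i j = 0 ∨ A i j = 1) {t δ e : ℝ}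
    {N : Matrix (Fin n) (Fin n) ℝ} (hN : Nᵀ = N) (hn : 0 < n) (hδ : 0 < δ) (he : 0 ≤ e)
    (hin : ∀ i j, SameCluster C i j → δ + N i j ≤ weightMatrix A t i j)
    (hout : ∀ i j, ¬ SameCluster C i j →
      weightMatrix A t i j ≤ N i j - δ + if i = j then e else 0)
    (hnorm : ∀ x, ‖toEuclideanLin N x‖ ≤ 40 * √(n : ℝ) * ‖x‖) (hen : e ≤ 8 * √(n : ℝ))
    (havg : ∀ i j, SameCluster C i i →
      |∑ l ∈ clusterOf C i, N l j| ≤ (clusterOf C i).card * (δ / 6))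
    (hKδ : 48 * √(n : ℝ) / K ≤ δ / 4) :
    IsUniqueOptimum A t (clusterMatrix C) := by
  set P := clusterProj C with hP
  set lam := 48 * √(n : ℝ) with hlam
  have hlam0 : 0 < lam := by positivity
  set D : Matrix (Fin n) (Fin n) ℝ := diagonal fun i => if SameCluster C i i then 0 else e with hD
  have hPD : P * D = 0 := by
    ext i j
    rw [hD, mul_diagonal, Matrix.zero_apply]
    by_cases h : SameCluster C j j
    · rw [if_pos h, mul_zero]
    · rw [hP, clusterProj_of_not_same fun h' => h h'.symm.left, zero_mul]
  have hDP : D * P = 0 := by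
    have := congrArg transpose hPD
    rwa [transpose_mul, transpose_zero, hP, clusterProj_transpose hC, hD, diagonal_transpose,
      ← hD, ← hP] at this
  have hDnorm : ∀ x, ‖toEuclideanLin D x‖ ≤ e * ‖x‖ := fun x => by
    refine (sq_le_sq₀ (norm_nonneg _) (by positivity)).1 ?_
    rw [mul_pow, EuclideanSpace.norm_sq_eq, EuclideanSpace.norm_sq_eq, Finset.mul_sum]
    refine Finset.sum_le_sum fun i _ => ?_
    rw [toLpLin_apply]
    simp only [hD, mulVec_diagonal, norm_mul, mul_pow]
    refine mul_le_mul_of_nonneg_right ?_ (by positivity)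
    rw [Real.norm_eq_abs, sq_abs]
    split_ifs
    · simpa using sq_nonneg e
    · exact le_rfl
  set S := lam⁻¹ • (N + D) with hS
  have hSnorm : ∀ x, ‖toEuclideanLin S x‖ ≤ ‖x‖ := fun x => by
    rw [hS, map_smul, LinearMap.smul_apply, norm_smul, map_add, LinearMap.add_apply, norm_inv,
      Real.norm_of_nonneg hlam0.le, inv_mul_le_iff₀ hlam0]
    refine (norm_add_le _ _).trans ((add_le_add (hnorm x) (hDnorm x)).trans ?_)
    rw [← add_mul]
    exact mul_le_mul_of_nonneg_right (by rw [hlam]; linarith) (norm_nonneg _)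
  set M := P + (1 - P) * S * (1 - P) with hM
  have hlamM : ∀ i j, lam * M i j = lam * P i j + (((1 - P) * N * (1 - P)) i j + D i j) := by
    intro i j
    have : (1 - P) * S * (1 - P) = lam⁻¹ • ((1 - P) * N * (1 - P) + D) := by
      rw [hS, mul_smul_comm, smul_mul_assoc]
      congr 1
      have : (1 - P) * (N + D) * (1 - P) =
        (1 - P) * N * (1 - P) + D - P * D - D * P + P * D * P := by noncomm_ring
      rw [this, hPD, hDP]
      simp
    rw [hM, this, Matrix.add_apply, Matrix.smul_apply, smul_eq_mul, Matrix.add_apply]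
    field_simp
  have hMY : ∑ i, ∑ j, M i j * clusterMatrix C i j = nuclearNorm (clusterMatrix C) := by
    rw [← sum_clusterProj_mul_clusterMatrix hC]
    have h0 : ∑ i, ∑ j, ((1 - P) * S * (1 - P)) i j * clusterMatrix C i j = 0 := by
      have : ((1 - P) * S * (1 - P))ᵀ * clusterMatrix C = 0 := by
        rw [transpose_mul, transpose_mul, transpose_sub, transpose_one, hP,
          clusterProj_transpose hC, ← clusterProj_mul_clusterMatrix hC]
        have : (1 - clusterProj C) * (Sᵀ * (1 - clusterProj C)) *
          (clusterProj C * clusterMatrix C) = (1 - clusterProj C) * Sᵀ *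
          ((clusterProj C - clusterProj C * clusterProj C) * clusterMatrix C) := by noncomm_ring
        rw [this, clusterProj_mul_self hC]
        simp
      have h2 := congrArg Matrix.trace this
      rw [trace_zero, Matrix.trace, Finset.sum_congr rfl fun i _ => by
        rw [diag_apply, mul_apply], Finset.sum_comm] at h2
      exact h2
    rw [← add_zero (∑ i, ∑ j, clusterProj C i j * clusterMatrix C i j), ← h0,
      ← Finset.sum_add_distrib]
    refine Finset.sum_congr rfl fun i _ => ?_
    rw [← Finset.sum_add_distrib]
    exact Finset.sum_congr rfl fun j _ => by rw [hM, Matrix.add_apply, add_mul]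
  have hPN : ∀ i j, |(P * N) i j| ≤ δ / 6 := fun i j => by
    rw [hP, clusterProj_mul_apply]
    by_cases h : SameCluster C i i
    · rw [abs_mul, abs_inv, Nat.abs_cast, inv_mul_le_iff₀ (card_clusterOf_pos h)]
      exact havg i j h
    · have : clusterOf C i = ∅ :=
        Finset.eq_empty_of_forall_notMem fun l hl => h (mem_clusterOf.1 hl).left
      rw [this]
      simp only [Finset.sum_empty, mul_zero, abs_zero]
      positivity
  have hT := abs_sub_compress_le hC hN hPN
  refine ⟨fun i j => ?_, fun Z hZ hne => ?_⟩
  · by_cases h : SameCluster C i j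
    · rw [clusterMatrix_of_same h]; norm_num
    · rw [clusterMatrix_of_not_same h]; norm_num
  rw [objective_eq hA, objective_eq hA, ← hlam]
  refine lt_of_certificate hlam0.le (norm_clusterProj_add_le hC hSnorm) hMY (fun i j h => ?_)
    (fun i j h => ?_) hZ hne
  · refine lt_of_lt_of_le ?_ (hin i j h)
    have hDij : D i j = 0 := by
      rw [hD, diagonal_apply, if_pos h.left]
      simp
    rw [← hP, ← hM, hlamM, hDij, add_zero]
    have h1 : lam * P i j ≤ δ / 4 := by
      refine le_trans ?_ hKδ
      rw [hP, clusterProj_of_same h, div_eq_mul_inv]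
      refine mul_le_mul_of_nonneg_left ?_ hlam0.le
      refine inv_anti₀ (by exact_mod_cast hK1) ?_
      exact_mod_cast le_card_clusterOf hK h
    have h2 := (abs_le.1 (hT i j)).1
    linarith
  · refine lt_of_le_of_lt (hout i j h) ?_
    have hDij : D i j = if i = j then e else 0 := by
      rw [hD, diagonal_apply]
      by_cases hij : i = j
      · subst hij
        simp [h]
      · simp [hij]
    rw [← hP, ← hM, hlamM, hDij, hP, clusterProj_of_not_same h, ← hP]
    have h2 := (abs_le.1 (hT i j)).2
    linarith

end DualCertificate

/-! ### Closed walks -/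

section ClosedWalks

variable {V W : Type*} {m : ℕ}

lemma sum_path_eq_sum_pow [Fintype V] [DecidableEq V] (A : Matrix V V ℝ) (m : ℕ) (g : V → V → ℝ) :
    ∑ w : Fin (m + 1) → V, (∏ j : Fin m, A (w j.castSucc) (w j.succ)) * g (w 0) (w (Fin.last m)) =
      ∑ a, ∑ b, (A ^ m) a b * g a b := by
  induction m generalizing g with
  | zero =>
    rw [← (Equiv.funUnique (Fin 1) V).symm.sum_comp]
    refine Finset.sum_congr rfl fun a _ => ?_
    simp [Matrix.one_apply]
  | succ m ih =>
    rw [← (Fin.consEquiv fun _ : Fin (m + 2) => V).sum_comp, Fintype.sum_prod_type]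
    refine Finset.sum_congr rfl fun a _ => ?_
    have h : ∀ w : Fin (m + 1) → V,
        (∏ j : Fin (m + 1), A ((Fin.consEquiv fun _ : Fin (m + 2) => V) (a, w) j.castSucc)
          ((Fin.consEquiv fun _ : Fin (m + 2) => V) (a, w) j.succ)) *
          g ((Fin.consEquiv fun _ : Fin (m + 2) => V) (a, w) 0)
            ((Fin.consEquiv fun _ : Fin (m + 2) => V) (a, w) (Fin.last (m + 1))) =
        (∏ j : Fin m, A (w j.castSucc) (w j.succ)) * (A a (w 0) * g a (w (Fin.last m))) := by
      intro w
      rw [Fin.prod_univ_succ]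
      simp only [Fin.consEquiv_apply, Fin.castSucc_zero, Fin.cons_zero, Fin.cons_succ,
        ← Fin.succ_castSucc, ← Fin.succ_last]
      ring
    rw [Finset.sum_congr rfl fun w _ => h w, ih fun b c => A a b * g a c, Finset.sum_comm]
    refine Finset.sum_congr rfl fun c _ => ?_
    rw [pow_succ', Matrix.mul_apply, Finset.sum_mul]
    exact Finset.sum_congr rfl fun b _ => by ring

lemma trace_pow_eq_sum_closed_walks [Fintype V] [DecidableEq V] (A : Matrix V V ℝ) (m : ℕ) :
    (A ^ (m + 1)).trace = ∑ w : Fin (m + 1) → V, ∏ j, A (w j) (w (j + 1)) := by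
  have h := sum_path_eq_sum_pow A m fun a b => A b a
  have h1 : (A ^ (m + 1)).trace = ∑ a, ∑ b, (A ^ m) a b * A b a := by
    rw [pow_succ, Matrix.trace]
    exact Finset.sum_congr rfl fun a _ => by rw [Matrix.diag_apply, Matrix.mul_apply]
  rw [h1, ← h]
  refine Finset.sum_congr rfl fun w _ => ?_
  rw [Fin.prod_univ_castSucc]
  simp [Fin.coeSucc_eq_succ]

/-- The `j`-th edge of a closed walk, whose positions are read cyclically. -/
def walkEdge (w : Fin (m + 1) → V) (j : Fin (m + 1)) : Sym2 V := s(w j, w (j + 1))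

/-- The number of times that a closed walk uses the edge `e`. -/
def walkMult [DecidableEq V] (w : Fin (m + 1) → V) (e : Sym2 V) : ℕ :=
  (Finset.univ.filter fun j => walkEdge w j = e).card

/-- A closed walk is repetitive if it uses none of its edges exactly once. -/
def IsRepetitive (w : Fin (m + 1) → V) : Prop :=
  ∀ j, ∃ j', j' ≠ j ∧ walkEdge w j' = walkEdge w j

/-- Two walks have the same shape if one is obtained from the other by relabelling the vertices. -/
def SameShape (w : Fin (m + 1) → V) (w' : Fin (m + 1) → W) : Prop :=
  ∀ i j, w i = w j ↔ w' i = w' j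

lemma SameShape.symm {w : Fin (m + 1) → V} {w' : Fin (m + 1) → W} (h : SameShape w w') :
    SameShape w' w := fun i j => (h i j).symm

lemma SameShape.isRepetitive {w : Fin (m + 1) → V} {w' : Fin (m + 1) → W} (h : SameShape w w')
    (hw : IsRepetitive w) : IsRepetitive w' := by
  intro j
  obtain ⟨j', hne, he⟩ := hw j
  refine ⟨j', hne, ?_⟩
  simp only [walkEdge, Sym2.eq_iff] at he ⊢
  simpa only [← h _ _] using he

lemma SameShape.card_image [DecidableEq V] [DecidableEq W] {w : Fin (m + 1) → V}
    {w' : Fin (m + 1) → W} (h : SameShape w w') :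
    (Finset.univ.image w).card = (Finset.univ.image w').card := by
  refine Finset.card_bij' (fun a _ => if ha : ∃ i, w i = a then w' ha.choose else w' 0)
    (fun b _ => if hb : ∃ i, w' i = b then w hb.choose else w 0) ?_ ?_ ?_ ?_
  · intro a ha
    split_ifs <;> simp
  · intro a ha
    split_ifs <;> simp
  · intro a ha
    obtain ⟨i, -, rfl⟩ := Finset.mem_image.1 ha
    have h1 : ∃ j, w j = w i := ⟨i, rfl⟩
    have h2 : ∃ j, w' j = w' h1.choose := ⟨_, rfl⟩
    rw [dif_pos h1, dif_pos h2]
    exact ((h _ _).2 h2.choose_spec).trans h1.choose_spec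
  · intro a ha
    obtain ⟨i, -, rfl⟩ := Finset.mem_image.1 ha
    have h1 : ∃ j, w' j = w' i := ⟨i, rfl⟩
    have h2 : ∃ j, w j = w h1.choose := ⟨_, rfl⟩
    rw [dif_pos h1, dif_pos h2]
    exact ((h _ _).1 h2.choose_spec).trans h1.choose_spec

lemma prod_walkEdge [Fintype V] [DecidableEq V] (ξ : Sym2 V → ℝ) (w : Fin (m + 1) → V) :
    ∏ j, ξ (walkEdge w j) = ∏ e, ξ e ^ walkMult w e := by
  rw [← Finset.prod_fiberwise Finset.univ (walkEdge w)]
  refine Finset.prod_congr rfl fun e _ => ?_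
  rw [Finset.prod_congr rfl fun j hj => by rw [(Finset.mem_filter.1 hj).2], Finset.prod_const,
    walkMult]

lemma sum_walkMult [Fintype V] [DecidableEq V] (w : Fin (m + 1) → V) :
    ∑ e, walkMult w e = m + 1 := by
  have := Finset.card_eq_sum_card_fiberwise (s := (Finset.univ : Finset (Fin (m + 1))))
    (t := (Finset.univ : Finset (Sym2 V))) (f := walkEdge w) (fun _ _ => Finset.mem_univ _)
  rw [Finset.card_univ, Fintype.card_fin] at this
  exact this.symm

lemma IsRepetitive.walkMult_ne_one [DecidableEq V] {w : Fin (m + 1) → V} (hw : IsRepetitive w)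
    (e : Sym2 V) :
    walkMult w e ≠ 1 := by
  intro h
  obtain ⟨j, hj⟩ := Finset.card_eq_one.1 h
  have hje : walkEdge w j = e := by
    have := hj ▸ Finset.mem_singleton_self j
    exact (Finset.mem_filter.1 this).2
  obtain ⟨j', hne, he⟩ := hw j
  have : j' ∈ Finset.univ.filter fun j => walkEdge w j = e :=
    Finset.mem_filter.2 ⟨Finset.mem_univ _, he.trans hje⟩
  rw [hj, Finset.mem_singleton] at this
  exact hne this

lemma exists_walkMult_eq_one [DecidableEq V] {w : Fin (m + 1) → V} (hw : ¬ IsRepetitive w) :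
    ∃ e, walkMult w e = 1 := by
  simp only [IsRepetitive, not_forall, not_exists, not_and] at hw
  obtain ⟨j, hj⟩ := hw
  refine ⟨walkEdge w j, Finset.card_eq_one.2 ⟨j, ?_⟩⟩
  ext j'
  rw [Finset.mem_filter, Finset.mem_singleton]
  refine ⟨fun h => ?_, fun h => ⟨Finset.mem_univ _, by rw [h]⟩⟩
  by_contra hne
  exact hj j' hne h.2

lemma walkMult_pos_iff [DecidableEq V] (w : Fin (m + 1) → V) (e : Sym2 V) :
    walkMult w e ≠ 0 ↔ e ∈ Finset.univ.image (walkEdge w) := by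
  rw [walkMult, Finset.card_ne_zero, Finset.mem_image]
  constructor
  · rintro ⟨j, hj⟩
    exact ⟨j, Finset.mem_univ _, (Finset.mem_filter.1 hj).2⟩
  · rintro ⟨j, -, hj⟩
    exact ⟨j, Finset.mem_filter.2 ⟨Finset.mem_univ _, hj⟩⟩

lemma card_vertices_le_card_edges_add_one [DecidableEq V] (w : ℕ → V) (l : ℕ) :
    ((Finset.range (l + 1)).image w).card ≤
      ((Finset.range l).image fun j => s(w j, w (j + 1))).card + 1 := by
  induction l with
  | zero => simp
  | succ l ih =>
    rw [Finset.range_add_one (n := l + 1), Finset.image_insert]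
    by_cases h : w (l + 1) ∈ (Finset.range (l + 1)).image w
    · rw [Finset.insert_eq_of_mem h]
      refine ih.trans (Nat.add_le_add_right (Finset.card_le_card ?_) 1)
      exact Finset.image_subset_image (Finset.range_subset_range.2 (by omega))
    · rw [Finset.card_insert_of_notMem h]
      have hE : (Finset.range (l + 1)).image (fun j => s(w j, w (j + 1))) =
          insert s(w l, w (l + 1)) ((Finset.range l).image fun j => s(w j, w (j + 1))) := by
        rw [Finset.range_add_one, Finset.image_insert]
      rw [hE, Finset.card_insert_of_notMem]
      · omega
      · -- an edge leading to a new vertex is new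
        intro hmem
        obtain ⟨j, hj, he⟩ := Finset.mem_image.1 hmem
        rw [Finset.mem_range] at hj
        apply h
        have : w (l + 1) ∈ s(w j, w (j + 1)) := by
          rw [he]; exact Sym2.mem_mk_right _ _
        rcases Sym2.mem_iff.1 this with h1 | h1
        · exact Finset.mem_image.2 ⟨j, Finset.mem_range.2 (by omega), h1.symm⟩
        · exact Finset.mem_image.2 ⟨j + 1, Finset.mem_range.2 (by omega), h1.symm⟩

/-- A closed walk is connected, so it has at most one more vertex than it has edges. -/
lemma card_walk_vertices_le [DecidableEq V] (w : Fin (m + 1) → V) :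
    (Finset.univ.image w).card ≤ (Finset.univ.image (walkEdge w)).card + 1 := by
  have hlt : ∀ j : Fin (m + 1), Fin.ofNat (m + 1) j.val = j := fun j => by simp
  have h := card_vertices_le_card_edges_add_one (fun j => w (Fin.ofNat (m + 1) j)) m
  have h1 : (Finset.range (m + 1)).image (fun j => w (Fin.ofNat (m + 1) j)) =
      Finset.univ.image w := by
    ext a
    simp only [Finset.mem_image, Finset.mem_range, Finset.mem_univ, true_and]
    constructor
    · rintro ⟨j, -, rfl⟩
      exact ⟨_, rfl⟩
    · rintro ⟨j, rfl⟩
      exact ⟨j, j.2, by rw [hlt]⟩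
  rw [h1] at h
  refine h.trans (Nat.add_le_add_right (Finset.card_le_card ?_) 1)
  intro e he
  obtain ⟨j, -, rfl⟩ := Finset.mem_image.1 he
  refine Finset.mem_image.2 ⟨Fin.ofNat (m + 1) j, Finset.mem_univ _, ?_⟩
  rw [walkEdge]
  congr 3
  ext
  simp [Fin.val_add]

/-! ### Comparing walks on two vertex sets -/

/-- The walks with the shape of `w` are the relabellings of the vertices of `w`. -/
noncomputable def sameShapeEquiv (w : Fin (m + 1) → V) :
    {w' : Fin (m + 1) → W // SameShape w w'} ≃ (Set.range w ↪ W) where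
  toFun w' := ⟨fun a => w'.1 a.2.choose, fun a b hab => by
    have h := (w'.2 _ _).2 hab
    rw [a.2.choose_spec, b.2.choose_spec] at h
    exact Subtype.ext h⟩
  invFun f := ⟨fun i => f ⟨w i, i, rfl⟩, fun i j => by
    exact (Subtype.mk_eq_mk (p := fun a => a ∈ Set.range w)).symm.trans f.injective.eq_iff.symm⟩
  left_inv w' := by
    ext i
    have h : ∃ j, w j = w i := ⟨i, rfl⟩
    exact (w'.2 _ _).1 h.choose_spec
  right_inv f := by
    ext a
    change f _ = f a
    congr 1
    exact Subtype.ext a.2.choose_spec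

open Classical in
lemma card_sameShape [DecidableEq V] [Fintype W] (w : Fin (m + 1) → V) :
    (Finset.univ.filter fun w' : Fin (m + 1) → W => SameShape w w').card =
      (Fintype.card W).descFactorial (Finset.univ.image w).card := by
  rw [← Fintype.card_subtype, Fintype.card_congr (sameShapeEquiv w), Fintype.card_embedding_eq]
  congr 1
  rw [← Set.toFinset_card, Set.toFinset_range]

lemma mul_pow_le_descFactorial {r N : ℕ} {x : ℝ} (hx : 0 ≤ x) (h : x + N ≤ r) (v : ℕ)
    (hv : v + 1 ≤ N) : r * x ^ v ≤ (r.descFactorial (v + 1) : ℝ) := by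
  induction v with
  | zero => simp
  | succ v ih =>
    have hvr : v + 1 ≤ r := by
      have : (N : ℝ) ≤ r := by linarith
      have : N ≤ r := by exact_mod_cast this
      omega
    rw [Nat.descFactorial_succ, Nat.cast_mul, Nat.cast_sub hvr, pow_succ]
    have h1 := ih (by omega)
    have h2 : x ≤ (r : ℝ) - (v + 1 : ℕ) := by
      have : ((v + 1 : ℕ) : ℝ) ≤ N := by exact_mod_cast (by omega : v + 1 ≤ N)
      linarith
    calc (r : ℝ) * (x ^ v * x) = x * (r * x ^ v) := by ring
      _ ≤ _ := mul_le_mul h2 h1 (by positivity) (hx.trans h2)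

lemma card_walk_image_mem [DecidableEq V] (w : Fin (m + 1) → V) :
    1 ≤ (Finset.univ.image w).card ∧ (Finset.univ.image w).card ≤ m + 1 :=
  ⟨Finset.card_pos.2 (Finset.univ_nonempty.image w), by
    simpa using Finset.card_image_le (s := (Finset.univ : Finset (Fin (m + 1)))) (f := w)⟩

open Classical in
/-- A sum over repetitive walks on `V`, damped by a factor `θ` per vertex, is controlled by the
number of repetitive walks on a much smaller vertex set `W`. Both sides are summed over the pairs of
walks with a common shape. -/
lemma sum_repetitive_le [Fintype V] [DecidableEq V] [Fintype W] [DecidableEq W] [Nonempty V]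
    {θ : ℝ} (hθ : 0 ≤ θ)
    (h : Fintype.card V * θ + (m + 1 : ℕ) ≤ Fintype.card W) :
    Fintype.card W * ∑ w : Fin (m + 1) → V with IsRepetitive w,
        θ ^ ((Finset.univ.image w).card - 1) ≤
      Fintype.card V *
        ((Finset.univ.filter fun w : Fin (m + 1) → W => IsRepetitive w).card : ℝ) := by
  set n := (Fintype.card V : ℝ) with hn
  have hn0 : 0 < n := by rw [hn]; exact_mod_cast Fintype.card_pos
  have hleft : ∀ w : Fin (m + 1) → V,
      Fintype.card W * θ ^ ((Finset.univ.image w).card - 1) ≤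
        ∑ w' : Fin (m + 1) → W with SameShape w w',
          (n ^ ((Finset.univ.image w').card - 1))⁻¹ := by
    intro w
    rw [Finset.sum_congr rfl fun w' hw' => by
      rw [← (Finset.mem_filter.1 hw').2.card_image], Finset.sum_const, card_sameShape,
      nsmul_eq_mul, ← div_eq_mul_inv, le_div_iff₀ (by positivity)]
    obtain ⟨h1, h2⟩ := card_walk_image_mem w
    have := mul_pow_le_descFactorial (x := n * θ) (by positivity) h
      ((Finset.univ.image w).card - 1) (by omega)
    rw [Nat.sub_add_cancel h1, mul_pow] at this
    linarith
  have hright : ∀ w' : Fin (m + 1) → W,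
      ∑ w : Fin (m + 1) → V with SameShape w' w,
          (n ^ ((Finset.univ.image w').card - 1))⁻¹ ≤ n := by
    intro w'
    rw [Finset.sum_const, card_sameShape, nsmul_eq_mul, ← div_eq_mul_inv,
      div_le_iff₀ (by positivity)]
    have h1 := (card_walk_image_mem w').1
    calc ((Fintype.card V).descFactorial (Finset.univ.image w').card : ℝ)
        ≤ ((Fintype.card V ^ (Finset.univ.image w').card : ℕ) : ℝ) := by
          exact_mod_cast Nat.descFactorial_le_pow _ _
      _ = n * n ^ ((Finset.univ.image w').card - 1) := by
          rw [Nat.cast_pow, ← hn, ← pow_succ', Nat.sub_add_cancel h1]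
  calc Fintype.card W * ∑ w : Fin (m + 1) → V with IsRepetitive w,
        θ ^ ((Finset.univ.image w).card - 1)
      ≤ ∑ w : Fin (m + 1) → V with IsRepetitive w, ∑ w' : Fin (m + 1) → W with SameShape w w',
          (n ^ ((Finset.univ.image w').card - 1))⁻¹ := by
        rw [Finset.mul_sum]
        exact Finset.sum_le_sum fun w _ => hleft w
    _ = ∑ w' : Fin (m + 1) → W with IsRepetitive w', ∑ w : Fin (m + 1) → V with SameShape w' w,
          (n ^ ((Finset.univ.image w').card - 1))⁻¹ := by
        refine Finset.sum_comm' fun w w' => ?_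
        simp only [Finset.mem_filter, Finset.mem_univ, true_and]
        exact ⟨fun h => ⟨h.2.symm, h.2.isRepetitive h.1⟩,
          fun h => ⟨h.1.isRepetitive h.2, h.1.symm⟩⟩
    _ ≤ ∑ w' : Fin (m + 1) → W with IsRepetitive w', n :=
        Finset.sum_le_sum fun w' _ => hright w'
    _ = n * ((Finset.univ.filter fun w : Fin (m + 1) → W => IsRepetitive w).card : ℝ) := by
        rw [Finset.sum_const, nsmul_eq_mul, mul_comm]

end ClosedWalks

/-! ### The golden two-point law -/

section GoldenLaw

open Real

/-- The two values of the golden law, the roots of `x ^ 2 = x + 1`. -/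
noncomputable def goldenValue (b : Bool) : ℝ := if b then goldenRatio else goldenConj

/-- The probabilities that make the golden law centred. -/
noncomputable def goldenWeight (b : Bool) : ℝ := if b then -goldenConj / √5 else goldenRatio / √5

lemma goldenWeight_nonneg (b : Bool) : 0 ≤ goldenWeight b := by
  unfold goldenWeight
  split_ifs
  · exact div_nonneg (by linarith [goldenConj_neg]) (by positivity)
  · exact div_nonneg goldenRatio_pos.le (by positivity)

lemma sum_goldenWeight : ∑ b, goldenWeight b = 1 := by
  have : (√5 : ℝ) ≠ 0 := by positivity
  simp only [Fintype.sum_bool, goldenWeight, if_true, Bool.false_eq_true, if_false]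
  rw [← add_div, div_eq_one_iff_eq this, ← goldenRatio_sub_goldenConj]
  ring

/-- The moments of the golden law; they are the Fibonacci numbers shifted by one. -/
noncomputable def goldenMoment (m : ℕ) : ℝ := ∑ b, goldenWeight b * goldenValue b ^ m

lemma goldenMoment_one : goldenMoment 1 = 0 := by
  simp only [goldenMoment, Fintype.sum_bool, goldenWeight, goldenValue, if_true,
    Bool.false_eq_true, if_false]
  ring

lemma goldenMoment_add_two (m : ℕ) :
    goldenMoment (m + 2) = goldenMoment (m + 1) + goldenMoment m := by
  simp only [goldenMoment, ← Finset.sum_add_distrib]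
  refine Finset.sum_congr rfl fun b _ => ?_
  have : goldenValue b ^ 2 = goldenValue b + 1 := by
    unfold goldenValue
    split_ifs
    · exact goldenRatio_sq
    · exact goldenConj_sq
  rw [pow_add, this]
  ring

lemma one_le_goldenMoment (m : ℕ) : 0 ≤ goldenMoment m ∧ (m ≠ 1 → 1 ≤ goldenMoment m) := by
  have h0 : goldenMoment 0 = 1 := by simpa [goldenMoment] using sum_goldenWeight
  have h2 : ∀ m, 1 ≤ goldenMoment (m + 2) ∧ 1 ≤ goldenMoment (m + 3) := by
    intro m
    induction m with
    | zero => simp [goldenMoment_add_two, goldenMoment_one, h0]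
    | succ m ih => exact ⟨ih.2, by rw [goldenMoment_add_two]; linarith [ih.1, ih.2]⟩
  match m with
  | 0 => simp [h0]
  | 1 => simp [goldenMoment_one]
  | m + 2 => exact ⟨by linarith [(h2 m).1], fun _ => (h2 m).1⟩

/-- Hoeffding's lemma for the golden law, whose two values are at distance `√5`. -/
lemma sum_goldenWeight_mul_exp_le (x : ℝ) :
    ∑ b, goldenWeight b * exp (x * goldenValue b) ≤ exp (5 * x ^ 2 / 8) := by
  set ρ : Measure ℝ := ENNReal.ofReal (goldenWeight true) • Measure.dirac (goldenValue true) +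
    ENNReal.ofReal (goldenWeight false) • Measure.dirac (goldenValue false) with hρ
  have hsum := sum_goldenWeight
  rw [Fintype.sum_bool] at hsum
  have hprob : IsProbabilityMeasure ρ := ⟨by
    simp only [hρ, Measure.add_apply, Measure.smul_apply, measure_univ, smul_eq_mul, mul_one]
    rw [← ENNReal.ofReal_add (goldenWeight_nonneg _) (goldenWeight_nonneg _), hsum,
      ENNReal.ofReal_one]⟩
  have hint : ∀ f : ℝ → ℝ, ∫ y, f y ∂ρ = ∑ b, goldenWeight b * f (goldenValue b) := by
    intro f
    rw [hρ, integral_add_measure, integral_smul_measure, integral_smul_measure, integral_dirac,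
      integral_dirac, Fintype.sum_bool, ENNReal.toReal_ofReal (goldenWeight_nonneg _),
      ENNReal.toReal_ofReal (goldenWeight_nonneg _)]
    · rfl
    · exact (integrable_dirac (by simp)).smul_measure ENNReal.ofReal_ne_top
    · exact (integrable_dirac (by simp)).smul_measure ENNReal.ofReal_ne_top
  have hmem : ∀ᵐ y ∂ρ, y ∈ Set.Icc goldenConj goldenRatio := by
    have hle : goldenConj ≤ goldenRatio := goldenConj_neg.le.trans goldenRatio_pos.le
    rw [hρ, ae_add_measure_iff]
    constructor <;> refine Measure.ae_smul_measure
      ((ae_dirac_iff (p := fun y => y ∈ Set.Icc goldenConj goldenRatio) measurableSet_Icc).2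
        ?_) _ <;>
      simp [goldenValue, hle]
  have hsub := hasSubgaussianMGF_of_mem_Icc_of_integral_eq_zero (μ := ρ) (X := id)
    aemeasurable_id hmem (by
      rw [hint]
      simpa [goldenMoment] using goldenMoment_one)
  have h := hsub.mgf_le x
  rw [mgf, hint] at h
  refine h.trans (le_of_eq ?_)
  congr 1
  have h5 : (√5 : ℝ) ^ 2 = 5 := sq_sqrt (by norm_num)
  simp only [goldenRatio_sub_goldenConj, NNReal.coe_pow, NNReal.coe_div, coe_nnnorm, norm_eq_abs,
    NNReal.coe_ofNat, div_pow, sq_abs, h5]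
  ring

/-- The expectation over independent golden variables indexed by `E`. -/
noncomputable def goldenExp {E : Type*} [Fintype E] [DecidableEq E] (f : (E → Bool) → ℝ) : ℝ :=
  ∑ s, (∏ e, goldenWeight (s e)) * f s

variable {E : Type*} [Fintype E] [DecidableEq E]

lemma goldenExp_mono {f g : (E → Bool) → ℝ} (h : ∀ s, f s ≤ g s) : goldenExp f ≤ goldenExp g :=
  Finset.sum_le_sum fun s _ => mul_le_mul_of_nonneg_left (h s)
    (Finset.prod_nonneg fun _ _ => goldenWeight_nonneg _)

lemma goldenExp_prod (f : E → Bool → ℝ) :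
    goldenExp (fun s => ∏ e, f e (s e)) = ∏ e, ∑ b, goldenWeight b * f e b := by
  rw [Finset.prod_univ_sum, Fintype.piFinset_univ, goldenExp]
  exact Finset.sum_congr rfl fun s _ => by rw [Finset.prod_mul_distrib]

lemma goldenExp_sum {ι : Type*} (t : Finset ι) (f : ι → (E → Bool) → ℝ) :
    goldenExp (fun s => ∑ i ∈ t, f i s) = ∑ i ∈ t, goldenExp (f i) := by
  simp only [goldenExp, Finset.mul_sum]
  rw [Finset.sum_comm]

lemma goldenExp_const_mul (c : ℝ) (f : (E → Bool) → ℝ) :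
    goldenExp (fun s => c * f s) = c * goldenExp f := by
  simp only [goldenExp, Finset.mul_sum]
  exact Finset.sum_congr rfl fun s _ => by ring

lemma goldenExp_add (f g : (E → Bool) → ℝ) :
    goldenExp (fun s => f s + g s) = goldenExp f + goldenExp g := by
  simp only [goldenExp, mul_add, Finset.sum_add_distrib]

lemma sum_prod_goldenWeight : ∑ s : E → Bool, ∏ e, goldenWeight (s e) = 1 := by
  have := goldenExp_prod fun (_ : E) _ => 1
  simpa only [goldenExp, mul_one, sum_goldenWeight, Finset.prod_const_one] using this

lemma goldenExp_pow_le {f : (E → Bool) → ℝ} (hf : ∀ s, 0 ≤ f s) (N : ℕ) :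
    goldenExp f ^ N ≤ goldenExp fun s => f s ^ N :=
  Real.pow_arith_mean_le_arith_mean_pow _ _ _
    (fun _ _ => Finset.prod_nonneg fun _ _ => goldenWeight_nonneg _) sum_prod_goldenWeight
    (fun s _ => hf s) N

/-- A linear form in independent golden variables is subgaussian. -/
lemma goldenExp_exp_le (c : E → ℝ) (x : ℝ) :
    goldenExp (fun s => exp (x * ∑ e, c e * goldenValue (s e))) ≤
      exp (5 * x ^ 2 / 8 * ∑ e, c e ^ 2) := by
  have h : ∀ s : E → Bool, exp (x * ∑ e, c e * goldenValue (s e)) =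
      ∏ e, exp (x * c e * goldenValue (s e)) := fun s => by
    rw [← exp_sum, Finset.mul_sum]
    exact congrArg _ (Finset.sum_congr rfl fun e _ => by ring)
  simp only [h]
  rw [goldenExp_prod fun e b => exp (x * c e * goldenValue b), Finset.mul_sum, exp_sum]
  refine Finset.prod_le_prod (fun e _ => Finset.sum_nonneg fun b _ =>
    mul_nonneg (goldenWeight_nonneg b) (exp_pos _).le) fun e _ => ?_
  refine (sum_goldenWeight_mul_exp_le _).trans (exp_le_exp.2 (le_of_eq ?_))
  ring

lemma goldenExp_pow_le_factorial (c : E → ℝ) {x : ℝ} (hx : 0 < x) (N : ℕ) :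
    goldenExp (fun s => (∑ e, c e * goldenValue (s e)) ^ (2 * N)) ≤
      2 * ((2 * N).factorial / x ^ (2 * N)) * exp (5 * x ^ 2 / 8 * ∑ e, c e ^ 2) := by
  set F : ℝ := (2 * N).factorial / x ^ (2 * N) with hF
  have hF0 : 0 ≤ F := by positivity
  have h : ∀ s : E → Bool, (∑ e, c e * goldenValue (s e)) ^ (2 * N) ≤
      F * (exp (x * ∑ e, c e * goldenValue (s e)) +
        exp (-x * ∑ e, c e * goldenValue (s e))) := fun s => by
    set u := ∑ e, c e * goldenValue (s e)
    have h1 : |x * u| ^ (2 * N) / (2 * N).factorial ≤ exp |x * u| :=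
      pow_div_factorial_le_exp _ (abs_nonneg _) _
    have h2 : exp |x * u| ≤ exp (x * u) + exp (-x * u) := by
      rcases abs_choice (x * u) with h | h <;> rw [h]
      · linarith [exp_pos (-x * u)]
      · rw [neg_mul]; linarith [exp_pos (x * u)]
    rw [(even_two_mul N).pow_abs, mul_pow] at h1
    calc u ^ (2 * N) = F * (x ^ (2 * N) * u ^ (2 * N) / (2 * N).factorial) := by
          rw [hF]; field_simp
      _ ≤ _ := mul_le_mul_of_nonneg_left (h1.trans h2) hF0
  refine (goldenExp_mono h).trans ?_
  rw [goldenExp_const_mul, goldenExp_add]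
  have h1 := goldenExp_exp_le c x
  have h2 := goldenExp_exp_le c (-x)
  rw [neg_sq] at h2
  nlinarith

end GoldenLaw

/-! ### The golden random matrix -/

section GoldenMatrix

open Matrix

/-- If `x` is a unit eigenvector of a symmetric `A` whose eigenvalue `a` is maximal in absolute
value, then the quadratic form of `A` is at least `0.79 |a|` in absolute value on the ball of
radius `0.1` around `x`. Hence its moments over the ball of radius `1.1` control `a`. -/
lemma IsHermitian.exists_spectralRadius {r : ℕ} (hr : 0 < r) {A : Matrix (Fin r) (Fin r) ℝ}
    (hA : A.IsHermitian) :
    ∃ a : ℝ, 0 ≤ a ∧ (∀ k, (A ^ (2 * k)).trace ≤ r * a ^ (2 * k)) ∧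
      ∀ N, volume.real (Metric.ball (0 : EuclideanSpace ℝ (Fin r)) (1 / 10)) *
        (79 / 100 * a) ^ (2 * N) ≤
        ∫ y in Metric.ball (0 : EuclideanSpace ℝ (Fin r)) (11 / 10),
          (inner ℝ y (toEuclideanLin A y)) ^ (2 * N) := by
  have : Nonempty (Fin r) := ⟨⟨0, hr⟩⟩
  obtain ⟨i, hi⟩ := Finite.exists_max fun i => |hA.eigenvalues i|
  set a := hA.eigenvalues i with ha
  refine ⟨|a|, abs_nonneg _, fun k => ?_, fun N => ?_⟩
  · rw [IsHermitian.trace_pow_eq_sum_eigenvalues_pow hA]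
    calc ∑ j, hA.eigenvalues j ^ (2 * k) ≤ ∑ _j : Fin r, |a| ^ (2 * k) :=
          Finset.sum_le_sum fun j _ => by
            rw [← (even_two_mul k).pow_abs (hA.eigenvalues j)]
            exact pow_le_pow_left₀ (abs_nonneg _) (hi j) _
      _ = r * |a| ^ (2 * k) := by simp
  set x := hA.eigenvectorBasis i with hx
  have hx1 : ‖x‖ = 1 := by simp [hx]
  have hAx : toEuclideanLin A x = a • x := by
    rw [toLpLin_apply, hx, hA.mulVec_eigenvectorBasis]; rfl
  have hsymm : ∀ y z, inner ℝ (toEuclideanLin A y) z = inner ℝ y (toEuclideanLin A z) :=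
    fun y z => (isSymmetric_toEuclideanLin_iff.2 hA) y z
  have hcont : Continuous fun y : EuclideanSpace ℝ (Fin r) => inner ℝ y (toEuclideanLin A y) :=
    continuous_id.inner (toEuclideanLin A).continuous_of_finiteDimensional
  have hlow : ∀ y ∈ Metric.ball x (1 / 10),
      (79 / 100 * |a|) ^ (2 * N) ≤ inner ℝ y (toEuclideanLin A y) ^ (2 * N) := by
    intro y hy
    rw [← (even_two_mul N).pow_abs (inner ℝ y (toEuclideanLin A y))]
    refine pow_le_pow_left₀ (by positivity) ?_ _
    set z := y - x with hz
    have hzn : ‖z‖ ≤ 1 / 10 := by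
      rw [hz, ← dist_eq_norm]; exact (Metric.mem_ball.1 hy).le
    have hyz : y = x + z := by rw [hz]; abel
    have hexp : inner ℝ y (toEuclideanLin A y) =
        a + 2 * (a * inner ℝ x z) + inner ℝ z (toEuclideanLin A z) := by
      have h1 : inner ℝ x (toEuclideanLin A z) = a * inner ℝ x z := by
        rw [← hsymm, hAx, inner_smul_left]; simp
      have h2 : inner ℝ z (a • x) = a * inner ℝ x z := by
        rw [inner_smul_right, real_inner_comm]
      have h3 : inner ℝ x (a • x) = a := by
        rw [inner_smul_right, real_inner_self_eq_norm_sq, hx1]; ring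
      rw [hyz, map_add, inner_add_left, inner_add_right, inner_add_right, hAx, h1, h2, h3]
      ring
    have hb1 : |a * inner ℝ x z| ≤ |a| * (1 / 10) := by
      rw [abs_mul]
      refine mul_le_mul_of_nonneg_left ?_ (abs_nonneg _)
      refine (abs_real_inner_le_norm _ _).trans ?_
      rw [hx1, one_mul]; exact hzn
    have hb2 : |inner ℝ z (toEuclideanLin A z)| ≤ |a| * (1 / 100) := by
      refine (abs_real_inner_le_norm _ _).trans ?_
      have h1 := IsHermitian.norm_apply_le_of_abs_eigenvalues_le hA (abs_nonneg a) hi z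
      calc ‖z‖ * ‖toEuclideanLin A z‖ ≤ ‖z‖ * (|a| * ‖z‖) :=
            mul_le_mul_of_nonneg_left h1 (norm_nonneg _)
        _ = |a| * (‖z‖ * ‖z‖) := by ring
        _ ≤ |a| * (1 / 10 * (1 / 10)) := by gcongr
        _ = |a| * (1 / 100) := by norm_num
    rw [hexp]
    rw [abs_le] at hb1 hb2
    rcases abs_cases a with ⟨h1, h2⟩ | ⟨h1, h2⟩ <;> rw [h1] at hb1 hb2 ⊢
    · exact le_trans (by linarith) (le_abs_self _)
    · exact le_trans (by linarith) (neg_le_abs _)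
  have hint : IntegrableOn (fun y => inner ℝ y (toEuclideanLin A y) ^ (2 * N))
      (Metric.ball (0 : EuclideanSpace ℝ (Fin r)) (11 / 10)) :=
    ((hcont.pow _).continuousOn.integrableOn_compact
      (isCompact_closedBall 0 (11 / 10))).mono_set Metric.ball_subset_closedBall
  have hsub : Metric.ball x (1 / 10) ⊆ Metric.ball 0 (11 / 10) := by
    refine Metric.ball_subset_ball' ?_
    rw [dist_zero_right, hx1]; norm_num
  calc volume.real (Metric.ball (0 : EuclideanSpace ℝ (Fin r)) (1 / 10)) *
        (79 / 100 * |a|) ^ (2 * N)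
      = ∫ y in Metric.ball x (1 / 10), (79 / 100 * |a|) ^ (2 * N) := by
        rw [setIntegral_const, smul_eq_mul, Measure.real, Measure.real,
          Measure.addHaar_ball_center volume x]
    _ ≤ ∫ y in Metric.ball x (1 / 10), inner ℝ y (toEuclideanLin A y) ^ (2 * N) := by
        refine setIntegral_mono_on ?_ (hint.mono_set hsub) Metric.isOpen_ball.measurableSet hlow
        exact integrableOn_const (by finiteness)
    _ ≤ _ := setIntegral_mono_set hint
        (Filter.Eventually.of_forall fun y => (even_two_mul N).pow_nonneg _)
        hsub.eventuallyLE

/-- The symmetric matrix of independent golden variables. -/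
noncomputable def goldenMatrix {r : ℕ} (s : Sym2 (Fin r) → Bool) : Matrix (Fin r) (Fin r) ℝ :=
  Matrix.of fun i j => goldenValue (s s(i, j))

lemma goldenMatrix_isHermitian {r : ℕ} (s : Sym2 (Fin r) → Bool) :
    (goldenMatrix s).IsHermitian := by
  ext i j
  simp [goldenMatrix, Sym2.eq_swap]

/-- The coefficient of the unordered pair `e` in the quadratic form of a symmetric matrix. -/
def pairCoeff {r : ℕ} (y : EuclideanSpace ℝ (Fin r)) (e : Sym2 (Fin r)) : ℝ :=
  ∑ p : Fin r × Fin r with s(p.1, p.2) = e, y p.1 * y p.2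

lemma inner_goldenMatrix {r : ℕ} (s : Sym2 (Fin r) → Bool) (y : EuclideanSpace ℝ (Fin r)) :
    inner ℝ y (toEuclideanLin (goldenMatrix s) y) = ∑ e, pairCoeff y e * goldenValue (s e) := by
  have h1 : inner ℝ y (toEuclideanLin (goldenMatrix s) y) =
      ∑ p : Fin r × Fin r, y p.1 * y p.2 * goldenValue (s s(p.1, p.2)) := by
    rw [Fintype.sum_prod_type, PiLp.inner_apply]
    refine Finset.sum_congr rfl fun i _ => ?_
    rw [toLpLin_apply]
    simp only [mulVec, dotProduct, goldenMatrix, of_apply, RCLike.inner_apply, conj_trivial,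
      Finset.sum_mul]
    exact Finset.sum_congr rfl fun j _ => by ring
  rw [h1, ← Finset.sum_fiberwise Finset.univ fun p : Fin r × Fin r => s(p.1, p.2)]
  refine Finset.sum_congr rfl fun e _ => ?_
  rw [pairCoeff, Finset.sum_mul]
  exact Finset.sum_congr rfl fun p hp => by rw [(Finset.mem_filter.1 hp).2]

lemma sum_pairCoeff_sq_le {r : ℕ} (y : EuclideanSpace ℝ (Fin r)) :
    ∑ e, pairCoeff y e ^ 2 ≤ 2 * (‖y‖ ^ 2) ^ 2 := by
  have h : ∀ e, pairCoeff y e ^ 2 ≤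
      2 * ∑ p : Fin r × Fin r with s(p.1, p.2) = e, (y p.1 * y p.2) ^ 2 := fun e => by
    refine sq_sum_le_card_mul_sum_sq.trans ?_
    refine mul_le_mul_of_nonneg_right ?_ (Finset.sum_nonneg fun _ _ => sq_nonneg _)
    induction e with
    | _ a b =>
      have : (Finset.univ.filter fun p : Fin r × Fin r => s(p.1, p.2) = s(a, b)) ⊆
          {(a, b), (b, a)} := by
        intro p hp
        have := (Finset.mem_filter.1 hp).2
        rw [Sym2.eq_iff] at this
        rw [Finset.mem_insert, Finset.mem_singleton]
        rcases this with h | h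
        · exact Or.inl (Prod.ext h.1 h.2)
        · exact Or.inr (Prod.ext h.1 h.2)
      exact_mod_cast (Finset.card_le_card this).trans Finset.card_le_two
  refine (Finset.sum_le_sum fun e _ => h e).trans (le_of_eq ?_)
  rw [← Finset.mul_sum, Finset.sum_fiberwise Finset.univ fun p : Fin r × Fin r => s(p.1, p.2),
    EuclideanSpace.real_norm_sq_eq, sq (∑ i, y i ^ 2), Finset.sum_mul_sum,
    Fintype.sum_prod_type]
  simp only [mul_pow]

/-- Moments of order `2 r` of the quadratic form of the golden matrix. -/
lemma goldenExp_inner_pow_le {r : ℕ} (hr : 8 ≤ r) {y : EuclideanSpace ℝ (Fin r)}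
    (hy : ‖y‖ ≤ 11 / 10) :
    goldenExp (fun s => inner ℝ y (toEuclideanLin (goldenMatrix s) y) ^ (2 * r)) ≤
      (11 * r : ℝ) ^ r := by
  have hr0 : (0 : ℝ) < r := by exact_mod_cast (by omega : 0 < r)
  -- `x ^ 2` is close to `4 r / (5 * 1.1 ^ 4)`, for which the bound on the exponential moments is
  -- `exp r`
  set x : ℝ := √(r / (1831 / 1000)) with hx
  have hx0 : 0 < x := Real.sqrt_pos.2 (by positivity)
  have hx2 : x ^ 2 = r / (1831 / 1000) := Real.sq_sqrt (by positivity)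
  have h := goldenExp_pow_le_factorial (pairCoeff y) hx0 r
  simp only [inner_goldenMatrix]
  refine h.trans ?_
  have hy2 : (‖y‖ ^ 2) ^ 2 ≤ 14641 / 10000 := by
    have : ‖y‖ ^ 2 ≤ 121 / 100 := by nlinarith [norm_nonneg y]
    nlinarith [sq_nonneg ‖y‖]
  have hexp : Real.exp (5 * x ^ 2 / 8 * ∑ e, pairCoeff y e ^ 2) ≤ (2719 / 1000 : ℝ) ^ r := by
    have h1 : 5 * x ^ 2 / 8 * ∑ e, pairCoeff y e ^ 2 ≤ (r : ℝ) := by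
      have := sum_pairCoeff_sq_le y
      calc 5 * x ^ 2 / 8 * ∑ e, pairCoeff y e ^ 2 ≤ 5 * x ^ 2 / 8 * (2 * (14641 / 10000)) := by
            gcongr; linarith
        _ ≤ (r : ℝ) := by rw [hx2]; linarith
    refine (Real.exp_le_exp.2 h1).trans ?_
    rw [← Real.exp_one_pow]
    exact pow_le_pow_left₀ (Real.exp_pos _).le (by linarith [Real.exp_one_lt_d9]) _
  have hfac : ((2 * r).factorial : ℝ) ≤ (2 * r ^ 2 : ℝ) ^ r := by
    have h1 : (2 * r).factorial ≤ (2 * r) ^ r * r ^ r :=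
      (Nat.factorial_two_mul_le r).trans (Nat.mul_le_mul_left _ (Nat.factorial_le_pow r))
    calc ((2 * r).factorial : ℝ) ≤ (((2 * r) ^ r * r ^ r : ℕ) : ℝ) := by exact_mod_cast h1
      _ = (2 * r ^ 2 : ℝ) ^ r := by
        push_cast
        rw [← mul_pow]; congr 1; ring
  have h2 : (2 : ℝ) ≤ (11 / 10) ^ r :=
    le_trans (by norm_num) (pow_le_pow_right₀ (by norm_num : (1 : ℝ) ≤ 11 / 10) hr)
  calc 2 * ((2 * r).factorial / x ^ (2 * r)) * Real.exp (5 * x ^ 2 / 8 * ∑ e, pairCoeff y e ^ 2)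
      ≤ (11 / 10) ^ r * ((2 * r ^ 2 : ℝ) ^ r / x ^ (2 * r)) * (2719 / 1000 : ℝ) ^ r := by gcongr
    _ = (11 / 10 * (2 * r ^ 2 / (r / (1831 / 1000))) * (2719 / 1000)) ^ r := by
        rw [pow_mul, hx2, ← div_pow, ← mul_pow, ← mul_pow]
    _ ≤ (11 * r : ℝ) ^ r := by
        refine pow_le_pow_left₀ (by positivity) ?_ _
        have : 2 * (r : ℝ) ^ 2 / (r / (1831 / 1000)) = 3662 / 1000 * r := by field_simp; norm_num
        rw [this]
        nlinarith

lemma goldenExp_trace_pow_le {k : ℕ} (hk : 1 ≤ k) :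
    goldenExp (fun s : Sym2 (Fin (8 * k)) → Bool => ((goldenMatrix s) ^ (2 * k)).trace) ≤
      8 * k * (1552 * k : ℝ) ^ k := by
  set r := 8 * k with hr
  have hr0 : (0 : ℝ) < r := by exact_mod_cast (by omega : 0 < r)
  choose a ha0 hatr haint using fun s : Sym2 (Fin r) → Bool =>
    IsHermitian.exists_spectralRadius (by omega : 0 < r) (goldenMatrix_isHermitian s)
  set B : Set (EuclideanSpace ℝ (Fin r)) := Metric.ball 0 (11 / 10) with hB
  set v := volume.real (Metric.ball (0 : EuclideanSpace ℝ (Fin r)) (1 / 10)) with hv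
  have hv0 : 0 < v := by
    rw [hv, Measure.real, ENNReal.toReal_pos_iff]
    exact ⟨Metric.measure_ball_pos _ _ (by norm_num), measure_ball_lt_top⟩
  have hvB : volume.real B = 11 ^ r * v := by
    have h1 := Measure.addHaar_ball_mul_of_pos volume (0 : EuclideanSpace ℝ (Fin r))
      (r := 11) (by norm_num) (1 / 10)
    rw [finrank_euclideanSpace_fin] at h1
    rw [hB, hv, show (11 / 10 : ℝ) = 11 * (1 / 10) by norm_num, Measure.real, h1,
      ENNReal.toReal_mul, ENNReal.toReal_ofReal (by positivity), Measure.real]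
  have hmom : goldenExp (fun s => a s ^ (2 * r)) ≤ (194 * r : ℝ) ^ r := by
    have hint : ∀ s : Sym2 (Fin r) → Bool, IntegrableOn
        (fun y => (∏ e, goldenWeight (s e)) *
          inner ℝ y (toEuclideanLin (goldenMatrix s) y) ^ (2 * r)) B := fun s => by
      have hcont : Continuous fun y : EuclideanSpace ℝ (Fin r) => (∏ e, goldenWeight (s e)) *
          inner ℝ y (toEuclideanLin (goldenMatrix s) y) ^ (2 * r) :=
        continuous_const.mul ((continuous_id.inner
          (toEuclideanLin (goldenMatrix s)).continuous_of_finiteDimensional).pow _)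
      exact (hcont.continuousOn.integrableOn_compact
        (isCompact_closedBall 0 (11 / 10))).mono_set Metric.ball_subset_closedBall
    have h1 : v * (79 / 100) ^ (2 * r) * goldenExp (fun s => a s ^ (2 * r)) ≤
        ∫ y in B, goldenExp fun s =>
          inner ℝ y (toEuclideanLin (goldenMatrix s) y) ^ (2 * r) := by
      rw [← goldenExp_const_mul]
      simp only [goldenExp]
      rw [integral_finsetSum _ fun s _ => hint s]
      refine Finset.sum_le_sum fun s _ => ?_
      rw [integral_const_mul]
      refine mul_le_mul_of_nonneg_left ?_ (Finset.prod_nonneg fun _ _ => goldenWeight_nonneg _)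
      have := haint s r
      rwa [mul_pow, ← mul_assoc] at this
    have h2 : ∫ y in B, goldenExp (fun s =>
        inner ℝ y (toEuclideanLin (goldenMatrix s) y) ^ (2 * r)) ≤
        ∫ y in B, (11 * r : ℝ) ^ r := by
      refine setIntegral_mono_on (integrable_finsetSum _ fun s _ => hint s)
        (integrableOn_const (by finiteness)) Metric.isOpen_ball.measurableSet fun y hy => ?_
      refine goldenExp_inner_pow_le (by omega) ?_
      rw [hB, Metric.mem_ball, dist_zero_right] at hy
      exact hy.le
    rw [setIntegral_const, smul_eq_mul, hvB] at h2
    have h3 : v * ((6241 / 10000) ^ r * goldenExp (fun s => a s ^ (2 * r))) ≤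
        v * (121 * r : ℝ) ^ r := by
      have := h1.trans h2
      rw [pow_mul] at this
      calc _ = v * ((79 / 100) ^ 2) ^ r * goldenExp (fun s => a s ^ (2 * r)) := by norm_num; ring
        _ ≤ _ := this
        _ = v * (121 * r : ℝ) ^ r := by
          rw [mul_comm ((11 : ℝ) ^ r), mul_assoc, ← mul_pow]; congr 2; ring
    have h4 := le_of_mul_le_mul_left h3 hv0
    rw [mul_comm, ← le_div_iff₀ (by positivity), ← div_pow] at h4
    refine h4.trans (pow_le_pow_left₀ (by positivity) ?_ _)
    rw [div_le_iff₀ (by norm_num)]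
    linarith
  have hjen : goldenExp (fun s => a s ^ (2 * k)) ≤ (1552 * k : ℝ) ^ k := by
    have h1 := goldenExp_pow_le (fun s => pow_nonneg (ha0 s) (2 * k)) 8
    have h2 : (fun s => (a s ^ (2 * k)) ^ 8) = fun s => a s ^ (2 * r) := by
      funext s
      rw [← pow_mul]; congr 1; omega
    rw [h2] at h1
    have h3 : (194 * r : ℝ) ^ r = ((1552 * k : ℝ) ^ k) ^ 8 := by
      rw [← pow_mul, hr, mul_comm k 8]
      push_cast
      congr 1
      ring
    rw [h3] at hmom
    exact le_of_pow_le_pow_left₀ (by norm_num) (by positivity) (h1.trans hmom)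
  calc goldenExp (fun s : Sym2 (Fin r) → Bool => ((goldenMatrix s) ^ (2 * k)).trace)
      ≤ goldenExp fun s => r * a s ^ (2 * k) := goldenExp_mono fun s => hatr s k
    _ = r * goldenExp fun s => a s ^ (2 * k) := goldenExp_const_mul _ _
    _ ≤ r * (1552 * k : ℝ) ^ k := mul_le_mul_of_nonneg_left hjen hr0.le
    _ = 8 * k * (1552 * k : ℝ) ^ k := by rw [hr]; push_cast; ring

open Classical in
/-- Every repetitive walk contributes at least `1` to the trace moment of the golden matrix, and the
other walks contribute nonnegatively. -/
lemma card_repetitive_le {k m : ℕ} (hk : 1 ≤ k) (hm : m + 1 = 2 * k) :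
    ((Finset.univ.filter fun w : Fin (m + 1) → Fin (8 * k) => IsRepetitive w).card : ℝ) ≤
      8 * k * (1552 * k : ℝ) ^ k := by
  refine le_trans ?_ (goldenExp_trace_pow_le hk)
  rw [← hm]
  simp only [trace_pow_eq_sum_closed_walks]
  rw [goldenExp_sum]
  have hw : ∀ w : Fin (m + 1) → Fin (8 * k),
      goldenExp (fun s => ∏ j, goldenMatrix s (w j) (w (j + 1))) =
        ∏ e, goldenMoment (walkMult w e) := fun w => by
    have h1 : ∀ s : Sym2 (Fin (8 * k)) → Bool, ∏ j, goldenMatrix s (w j) (w (j + 1)) =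
        ∏ e, goldenValue (s e) ^ walkMult w e := fun s =>
      prod_walkEdge (fun e => goldenValue (s e)) w
    simp only [h1]
    exact goldenExp_prod fun e b => goldenValue b ^ walkMult w e
  rw [Finset.sum_congr rfl fun w _ => hw w, Finset.card_filter, Nat.cast_sum]
  refine Finset.sum_le_sum fun w _ => ?_
  split_ifs with h
  · rw [Nat.cast_one]
    exact Finset.one_le_prod fun e _ => (one_le_goldenMoment _).2 (h.walkMult_ne_one e)
  · rw [Nat.cast_zero]
    exact Finset.prod_nonneg fun e _ => (one_le_goldenMoment _).1

end GoldenMatrix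

/-! ### The spectral norm of the noise -/

section Noise

open Matrix

/-- Independent centred random variables, bounded by `L` and with variance at most `4`. -/
structure IsNoise {Ω : Type*} [MeasurableSpace Ω] (μ : Measure Ω) {ι : Type*} (L : ℝ)
    (ξ : ι → Ω → ℝ) : Prop where
  indep : iIndepFun ξ μ
  measurable : ∀ e, Measurable (ξ e)
  abs_le : ∀ e ω, |ξ e ω| ≤ L
  integral_eq_zero : ∀ e, ∫ ω, ξ e ω ∂μ = 0
  integral_sq_le : ∀ e, ∫ ω, ξ e ω ^ 2 ∂μ ≤ 4

/-- The random symmetric matrix with entries `ξ` on the unordered pairs. -/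
def noiseMatrix {Ω : Type*} {n : ℕ} (ξ : Sym2 (Fin n) → Ω → ℝ) (ω : Ω) :
    Matrix (Fin n) (Fin n) ℝ := Matrix.of fun i j => ξ s(i, j) ω

lemma noiseMatrix_isHermitian {Ω : Type*} {n : ℕ} (ξ : Sym2 (Fin n) → Ω → ℝ) (ω : Ω) :
    (noiseMatrix ξ ω).IsHermitian := by
  ext i j
  simp [noiseMatrix, Sym2.eq_swap]

variable {Ω : Type*} [MeasurableSpace Ω] {μ : Measure Ω} {ι : Type*} {L : ℝ} {n : ℕ}

lemma IsNoise.integral_walk {m : ℕ} {ξ : Sym2 (Fin n) → Ω → ℝ} (h : IsNoise μ L ξ)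
    (w : Fin (m + 1) → Fin n) :
    ∫ ω, ∏ j, noiseMatrix ξ ω (w j) (w (j + 1)) ∂μ =
      ∏ e, ∫ ω, ξ e ω ^ walkMult w e ∂μ := by
  have h1 : ∀ ω, ∏ j, noiseMatrix ξ ω (w j) (w (j + 1)) = ∏ e, ξ e ω ^ walkMult w e :=
    fun ω => prod_walkEdge (fun e => ξ e ω) w
  simp only [h1]
  exact h.indep.integral_fun_prod_comp (f := fun e x => x ^ walkMult w e)
    (fun e => (h.measurable e).aemeasurable) fun e => by fun_prop

variable [IsProbabilityMeasure μ]

lemma IsNoise.integrable_pow {ξ : ι → Ω → ℝ} (h : IsNoise μ L ξ) (e : ι) (m : ℕ) :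
    Integrable (fun ω => ξ e ω ^ m) μ := by
  refine Integrable.of_bound ((h.measurable e).pow_const m).aestronglyMeasurable (L ^ m) ?_
  refine Filter.Eventually.of_forall fun ω => ?_
  rw [Real.norm_eq_abs, abs_pow]
  exact pow_le_pow_left₀ (abs_nonneg _) (h.abs_le e ω) _

lemma IsNoise.abs_integral_pow_le {ξ : ι → Ω → ℝ} (h : IsNoise μ L ξ) {Λ : ℝ} (hL : L ≤ Λ)
    (hΛ : 0 < Λ) (e : ι) {m : ℕ} (hm : 2 ≤ m) :
    |∫ ω, ξ e ω ^ m ∂μ| ≤ 4 / Λ ^ 2 * Λ ^ m := by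
  obtain ⟨m, rfl⟩ := Nat.exists_eq_add_of_le hm
  have h1 : |∫ ω, ξ e ω ^ (2 + m) ∂μ| ≤ ∫ ω, Λ ^ m * ξ e ω ^ 2 ∂μ := by
    refine (abs_integral_le_integral_abs).trans ?_
    refine integral_mono (h.integrable_pow e _).abs ((h.integrable_pow e 2).const_mul _)
      fun ω => ?_
    simp only
    rw [abs_pow, pow_add, sq_abs, mul_comm]
    exact mul_le_mul_of_nonneg_right
      (pow_le_pow_left₀ (abs_nonneg _) ((h.abs_le e ω).trans hL) _) (sq_nonneg _)
  rw [integral_const_mul] at h1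
  refine h1.trans ((mul_le_mul_of_nonneg_left (h.integral_sq_le e) (by positivity)).trans
    (le_of_eq ?_))
  rw [pow_add]
  field_simp

/-- A walk that uses an edge exactly once has zero expectation. For a repetitive walk, the damping
factor `4 / Λ ^ 2` is gained once per edge, hence once per vertex other than the first. -/
lemma IsNoise.integral_walk_le {m : ℕ} {ξ : Sym2 (Fin n) → Ω → ℝ} (h : IsNoise μ L ξ) {Λ : ℝ}
    (hL : L ≤ Λ) (hΛ : 2 ≤ Λ) {w : Fin (m + 1) → Fin n} :
    (IsRepetitive w → ∫ ω, ∏ j, noiseMatrix ξ ω (w j) (w (j + 1)) ∂μ ≤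
      Λ ^ (m + 1) * (4 / Λ ^ 2) ^ ((Finset.univ.image w).card - 1)) ∧
    (¬ IsRepetitive w → ∫ ω, ∏ j, noiseMatrix ξ ω (w j) (w (j + 1)) ∂μ = 0) := by
  have hΛ0 : 0 < Λ := by linarith
  have hθ1 : 4 / Λ ^ 2 ≤ 1 := by
    rw [div_le_one (by positivity)]; nlinarith
  rw [h.integral_walk]
  refine ⟨fun hw => ?_, fun hw => ?_⟩
  · refine (le_abs_self _).trans ?_
    rw [Finset.abs_prod]
    have hle : ∀ e, |∫ ω, ξ e ω ^ walkMult w e ∂μ| ≤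
        (if e ∈ Finset.univ.image (walkEdge w) then 4 / Λ ^ 2 else 1) * Λ ^ walkMult w e := by
      intro e
      by_cases h0 : walkMult w e = 0
      · rw [if_neg fun he => (walkMult_pos_iff w e).2 he h0, h0]
        simp
      · rw [if_pos ((walkMult_pos_iff w e).1 h0)]
        exact h.abs_integral_pow_le hL hΛ0 e (by have := hw.walkMult_ne_one e; omega)
    refine (Finset.prod_le_prod (fun e _ => abs_nonneg _) fun e _ => hle e).trans ?_
    rw [Finset.prod_mul_distrib, Finset.prod_pow_eq_pow_sum, sum_walkMult, Finset.prod_ite_mem,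
      Finset.univ_inter, Finset.prod_const, mul_comm]
    refine mul_le_mul_of_nonneg_left (pow_le_pow_of_le_one (by positivity) hθ1 ?_) (by positivity)
    have := card_walk_vertices_le w
    omega
  · obtain ⟨e, he⟩ := exists_walkMult_eq_one hw
    refine Finset.prod_eq_zero (Finset.mem_univ e) ?_
    rw [he]
    simpa using h.integral_eq_zero e

lemma IsNoise.integrable_walk {m : ℕ} {ξ : Sym2 (Fin n) → Ω → ℝ} (h : IsNoise μ L ξ)
    (w : Fin (m + 1) → Fin n) :
    Integrable (fun ω => ∏ j, noiseMatrix ξ ω (w j) (w (j + 1))) μ := by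
  refine Integrable.of_bound (Finset.measurable_fun_prod _ fun j _ =>
    h.measurable s(w j, w (j + 1))).aestronglyMeasurable (∏ _j : Fin (m + 1), L) ?_
  refine Filter.Eventually.of_forall fun ω => ?_
  rw [Real.norm_eq_abs, Finset.abs_prod]
  exact Finset.prod_le_prod (fun _ _ => abs_nonneg _) fun j _ => h.abs_le _ ω

lemma IsNoise.integral_trace_pow_le {k : ℕ} (hk : 1 ≤ k) (hn : 0 < n)
    {ξ : Sym2 (Fin n) → Ω → ℝ} (h : IsNoise μ L ξ) {Λ : ℝ} (hL : L ≤ Λ) (hΛ : 2 ≤ Λ)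
    (hΛk : Λ ^ 2 * (6 * k) = 4 * n) :
    ∫ ω, ((noiseMatrix ξ ω) ^ (2 * k)).trace ∂μ ≤ n * (1035 * n : ℝ) ^ k := by
  classical
  obtain ⟨m, hm⟩ : ∃ m, m + 1 = 2 * k := ⟨2 * k - 1, by omega⟩
  have hk0 : (0 : ℝ) < k := by exact_mod_cast hk
  have hΛ0 : 0 < Λ := by linarith
  have : Nonempty (Fin n) := ⟨⟨0, hn⟩⟩
  rw [← hm]
  simp only [trace_pow_eq_sum_closed_walks]
  rw [integral_finsetSum _ fun w _ => h.integrable_walk w]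
  have h1 : ∑ w : Fin (m + 1) → Fin n, ∫ ω, ∏ j, noiseMatrix ξ ω (w j) (w (j + 1)) ∂μ ≤
      Λ ^ (m + 1) * ∑ w : Fin (m + 1) → Fin n with IsRepetitive w,
        (4 / Λ ^ 2) ^ ((Finset.univ.image w).card - 1) := by
    rw [Finset.sum_filter, Finset.mul_sum]
    refine Finset.sum_le_sum fun w _ => ?_
    split_ifs with hw
    · exact (h.integral_walk_le hL hΛ).1 hw
    · rw [(h.integral_walk_le hL hΛ).2 hw, mul_zero]
  refine h1.trans ?_
  have hθ : (n : ℝ) * (4 / Λ ^ 2) = 6 * k := by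
    rw [mul_div_assoc', div_eq_iff (by positivity)]
    linarith
  have h2 := sum_repetitive_le (V := Fin n) (W := Fin (8 * k)) (m := m) (θ := 4 / Λ ^ 2)
    (by positivity) (by
      rw [Fintype.card_fin, Fintype.card_fin, hθ, hm]
      push_cast
      linarith)
  rw [Fintype.card_fin, Fintype.card_fin] at h2
  have h3 := h2.trans (mul_le_mul_of_nonneg_left (card_repetitive_le hk hm) (Nat.cast_nonneg n))
  have h4 : ∑ w : Fin (m + 1) → Fin n with IsRepetitive w,
      (4 / Λ ^ 2) ^ ((Finset.univ.image w).card - 1) ≤ n * (1552 * k : ℝ) ^ k := by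
    push_cast at h3
    refine le_of_mul_le_mul_left ?_ (by positivity : (0 : ℝ) < 8 * k)
    linarith
  refine (mul_le_mul_of_nonneg_left h4 (by positivity)).trans ?_
  rw [hm, pow_mul, mul_left_comm, ← mul_pow]
  refine mul_le_mul_of_nonneg_left (pow_le_pow_left₀ (by positivity) ?_ _) (Nat.cast_nonneg n)
  nlinarith

/-- The spectral norm of the noise is at most `40 √n` with high probability. -/
lemma IsNoise.measureReal_norm_gt_le {k : ℕ} (hk : 1 ≤ k) (hn : 0 < n)
    {ξ : Sym2 (Fin n) → Ω → ℝ} (h : IsNoise μ L ξ) {Λ : ℝ} (hL : L ≤ Λ) (hΛ : 2 ≤ Λ)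
    (hΛk : Λ ^ 2 * (6 * k) = 4 * n) :
    μ.real {ω | ¬ ∀ x, ‖toEuclideanLin (noiseMatrix ξ ω) x‖ ≤ 40 * √(n : ℝ) * ‖x‖} ≤
      n * (13 / 20 : ℝ) ^ k := by
  have hn0 : (0 : ℝ) < n := by exact_mod_cast hn
  have hτ : (40 * √(n : ℝ)) ^ (2 * k) = (1600 * n : ℝ) ^ k := by
    rw [pow_mul, mul_pow, Real.sq_sqrt hn0.le]; norm_num
  have hint : Integrable (fun ω => ((noiseMatrix ξ ω) ^ (2 * k)).trace) μ := by
    obtain ⟨m, hm⟩ : ∃ m, m + 1 = 2 * k := ⟨2 * k - 1, by omega⟩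
    rw [← hm]
    simp only [trace_pow_eq_sum_closed_walks]
    exact integrable_finsetSum _ fun w _ => h.integrable_walk w
  have h1 := mul_meas_ge_le_integral_of_nonneg (μ := μ)
    (f := fun ω => ((noiseMatrix ξ ω) ^ (2 * k)).trace)
    (Filter.Eventually.of_forall fun ω => by
      simp only [Pi.zero_apply]
      rw [IsHermitian.trace_pow_eq_sum_eigenvalues_pow (noiseMatrix_isHermitian ξ ω)]
      exact Finset.sum_nonneg fun i _ => (even_two_mul k).pow_nonneg _)
    hint ((40 * √(n : ℝ)) ^ (2 * k))
  have h2 := h1.trans (h.integral_trace_pow_le hk hn hL hΛ hΛk)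
  have h3 : μ.real {ω | ¬ ∀ x, ‖toEuclideanLin (noiseMatrix ξ ω) x‖ ≤ 40 * √(n : ℝ) * ‖x‖} ≤
      μ.real {ω | (40 * √(n : ℝ)) ^ (2 * k) ≤ ((noiseMatrix ξ ω) ^ (2 * k)).trace} := by
    refine measureReal_mono fun ω hω => ?_
    by_contra hlt
    exact hω (IsHermitian.norm_apply_le_of_trace_pow_le (noiseMatrix_isHermitian ξ ω)
      (by positivity) (by omega) (not_le.1 hlt).le)
  refine h3.trans ?_
  rw [hτ, mul_comm, ← le_div_iff₀ (by positivity), mul_div_assoc, ← div_pow] at h2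
  rw [hτ]
  refine h2.trans (mul_le_mul_of_nonneg_left (pow_le_pow_left₀ (by positivity) ?_ _) hn0.le)
  rw [mul_div_mul_right _ _ hn0.ne']
  norm_num

/-! ### Concentration of sums -/

lemma IsNoise.mgf_le {ξ : ι → Ω → ℝ} (h : IsNoise μ L ξ) (e : ι) {x : ℝ} (hx : |x| * L ≤ 1) :
    mgf (ξ e) μ x ≤ Real.exp (4 * x ^ 2) := by
  have hb : ∀ ω, |x * ξ e ω| ≤ 1 := fun ω => by
    rw [abs_mul]
    exact (mul_le_mul_of_nonneg_left (h.abs_le e ω) (abs_nonneg x)).trans hx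
  have hle : ∀ ω, Real.exp (x * ξ e ω) ≤ 1 + x * ξ e ω ^ 1 + x ^ 2 * ξ e ω ^ 2 := fun ω => by
    have := (_root_.abs_le.1 (Real.abs_exp_sub_one_sub_id_le (hb ω))).2
    rw [mul_pow] at this
    rw [pow_one]
    linarith
  have h1 := (h.integrable_pow e 1).const_mul x
  have h2 := (h.integrable_pow e 2).const_mul (x ^ 2)
  have h01 : Integrable (fun ω => 1 + x * ξ e ω ^ 1) μ := (integrable_const 1).add h1
  have h12 : Integrable (fun ω => 1 + x * ξ e ω ^ 1 + x ^ 2 * ξ e ω ^ 2) μ := h01.add h2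
  calc mgf (ξ e) μ x ≤ ∫ ω, (1 + x * ξ e ω ^ 1 + x ^ 2 * ξ e ω ^ 2) ∂μ := by
        refine integral_mono_of_nonneg (Filter.Eventually.of_forall fun ω => (Real.exp_pos _).le)
          h12 (Filter.Eventually.of_forall hle)
    _ = 1 + x ^ 2 * ∫ ω, ξ e ω ^ 2 ∂μ := by
        rw [integral_add h01 h2,
          integral_add (integrable_const 1) h1, integral_const_mul, integral_const_mul]
        simp [h.integral_eq_zero e]
    _ ≤ 1 + x ^ 2 * 4 := by
        have := h.integral_sq_le e
        gcongr
    _ ≤ Real.exp (4 * x ^ 2) := by linarith [Real.add_one_le_exp (4 * x ^ 2)]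

lemma IsNoise.measureReal_sum_ge_le {ξ : ι → Ω → ℝ} (h : IsNoise μ L ξ) (s : Finset ι) {η : ℝ}
    (hη : 0 ≤ η) (hηL : η * L ≤ 8) :
    μ.real {ω | s.card * η < |∑ e ∈ s, ξ e ω|} ≤ 2 * Real.exp (-(s.card * η ^ 2 / 16)) := by
  have hmgf : ∀ x : ℝ, |x| = η / 8 → mgf (∑ e ∈ s, ξ e) μ x ≤
      Real.exp (s.card * η ^ 2 / 16) := fun x hx => by
    rw [h.indep.mgf_sum h.measurable]
    refine (Finset.prod_le_prod (fun e _ => mgf_nonneg) fun e _ =>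
      h.mgf_le e (by rw [hx]; linarith)).trans ?_
    rw [Finset.prod_const, ← Real.exp_nat_mul, ← sq_abs x, hx]
    exact Real.exp_le_exp.2 (le_of_eq (by ring))
  have hint : ∀ x : ℝ, Integrable (fun ω => Real.exp (x * (∑ e ∈ s, ξ e) ω)) μ := fun x => by
    refine Integrable.of_bound (C := Real.exp (|x| * ∑ e ∈ s, L)) ?_ ?_
    · refine (Measurable.exp (measurable_const.mul ?_)).aestronglyMeasurable
      rw [show (∑ e ∈ s, ξ e) = fun ω => ∑ e ∈ s, ξ e ω from funext fun ω => by simp]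
      exact Finset.measurable_fun_sum _ fun e _ => h.measurable e
    · refine Filter.Eventually.of_forall fun ω => ?_
      rw [Real.norm_of_nonneg (Real.exp_pos _).le, Finset.sum_apply]
      refine Real.exp_le_exp.2 ((le_abs_self _).trans ?_)
      rw [abs_mul]
      refine mul_le_mul_of_nonneg_left ((Finset.abs_sum_le_sum_abs _ _).trans ?_) (abs_nonneg _)
      exact Finset.sum_le_sum fun e _ => h.abs_le e ω
  have hup := measure_ge_le_exp_mul_mgf (s.card * η) (by positivity : 0 ≤ η / 8) (hint (η / 8))
  have hlo := measure_le_le_exp_mul_mgf (-(s.card * η)) (by linarith : -(η / 8) ≤ 0)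
    (hint (-(η / 8)))
  have he : ∀ x : ℝ, Real.exp x * Real.exp (s.card * η ^ 2 / 16) =
      Real.exp (x + s.card * η ^ 2 / 16) := fun x => (Real.exp_add _ _).symm
  have hup' := hup.trans (mul_le_mul_of_nonneg_left
    (hmgf (η / 8) (abs_of_nonneg (by positivity))) (Real.exp_pos _).le)
  have hlo' := hlo.trans (mul_le_mul_of_nonneg_left
    (hmgf (-(η / 8)) (by rw [abs_neg]; exact abs_of_nonneg (by positivity))) (Real.exp_pos _).le)
  rw [he] at hup' hlo'
  have hsub : {ω | s.card * η < |∑ e ∈ s, ξ e ω|} ⊆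
      {ω | s.card * η ≤ (∑ e ∈ s, ξ e) ω} ∪ {ω | (∑ e ∈ s, ξ e) ω ≤ -(s.card * η)} := by
    intro ω hω
    simp only [Set.mem_ofPred_eq, Set.mem_union, Finset.sum_apply] at hω ⊢
    rcases lt_abs.1 hω with h | h
    · exact Or.inl h.le
    · exact Or.inr (by linarith)
  refine (measureReal_mono hsub).trans ((measureReal_union_le _ _).trans ?_)
  have e1 : -(η / 8) * (s.card * η) + s.card * η ^ 2 / 16 = -(s.card * η ^ 2 / 16) := by ring
  have e2 : -(-(η / 8)) * -(s.card * η) + s.card * η ^ 2 / 16 = -(s.card * η ^ 2 / 16) := by ring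
  rw [e1] at hup'
  rw [e2] at hlo'
  linarith

end Noise

/-! ### The coupling -/

section Coupling

lemma map_pred_eq_map_pred {Ω Ω' : Type*} [MeasurableSpace Ω] [MeasurableSpace Ω']
    {μ : Measure Ω} {ν : Measure Ω'} [IsProbabilityMeasure μ] [IsProbabilityMeasure ν]
    {P : Ω → Prop} {Q : Ω' → Prop} (hP : Measurable P) (hQ : Measurable Q)
    (h : μ {ω | P ω} = ν {u | Q u}) : μ.map P = ν.map Q := by
  refine Measure.ext_of_singleton fun a => ?_
  rw [Measure.map_apply hP (measurableSet_singleton a),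
    Measure.map_apply hQ (measurableSet_singleton a)]
  by_cases ha : a
  · have h1 : P ⁻¹' {a} = {ω | P ω} := by ext; simp [ha]
    have h2 : Q ⁻¹' {a} = {ω | Q ω} := by ext; simp [ha]
    rw [h1, h2, h]
  · have h1 : P ⁻¹' {a} = {ω | P ω}ᶜ := by ext; simp [ha]
    have h2 : Q ⁻¹' {a} = {ω | Q ω}ᶜ := by ext; simp [ha]
    rw [h1, h2, prob_compl_eq_one_sub (measurableSet_setOfPred.2 hP),
      prob_compl_eq_one_sub (measurableSet_setOfPred.2 hQ), h]

/-- The joint law of independent events is determined by their probabilities. -/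
lemma measureReal_eq_of_iIndepFun {Ω Ω' E : Type*} [MeasurableSpace Ω] [MeasurableSpace Ω']
    {μ : Measure Ω} {ν : Measure Ω'} [IsProbabilityMeasure μ] [IsProbabilityMeasure ν] [Fintype E]
    {X : E → Ω → Prop} {X' : E → Ω' → Prop} (hX : ∀ e, Measurable (X e))
    (hX' : ∀ e, Measurable (X' e)) (hi : iIndepFun X μ) (hi' : iIndepFun X' ν)
    (h : ∀ e, μ {ω | X e ω} = ν {u | X' e u}) (T : Set (E → Prop)) :
    μ.real {ω | (fun e => X e ω) ∈ T} = ν.real {u | (fun e => X' e u) ∈ T} := by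
  have hT : MeasurableSet T := T.toFinite.measurableSet
  have hmap : μ.map (fun ω e => X e ω) = ν.map (fun u e => X' e u) := by
    rw [(iIndepFun_iff_map_fun_eq_pi_map fun e => (hX e).aemeasurable).1 hi,
      (iIndepFun_iff_map_fun_eq_pi_map fun e => (hX' e).aemeasurable).1 hi']
    congr 1
    funext e
    exact map_pred_eq_map_pred (hX e) (hX' e) (h e)
  have h1 : μ.map (fun ω e => X e ω) T = ν.map (fun u e => X' e u) T := by rw [hmap]
  rw [Measure.map_apply (measurable_pi_lambda _ hX) hT,
    Measure.map_apply (measurable_pi_lambda _ hX') hT] at h1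
  exact congrArg ENNReal.toReal h1

lemma iIndepSet.iIndepFun_mem {Ω E : Type*} [MeasurableSpace Ω] {μ : Measure Ω}
    {s : E → Set Ω} (h : iIndepSet s μ) : iIndepFun (fun e ω => ω ∈ s e) μ := by
  have h1 := (iIndepSet.iIndepFun_indicator (β := ℝ) h).comp (fun _ x => x = 1)
    (fun _ => measurableSet_setOfPred.1 (measurableSet_singleton (1 : ℝ)))
  refine h1.congr fun e => Filter.Eventually.of_forall fun ω => ?_
  by_cases hω : ω ∈ s e <;> simp [hω]

/-- The uniform law on the unit interval. -/
noncomputable def uniformLaw : Measure ℝ := volume.restrict (Set.Icc 0 1)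

instance : IsProbabilityMeasure uniformLaw := ⟨by simp [uniformLaw]⟩

lemma uniformLaw_le {c : ℝ} (h1 : c ≤ 1) :
    uniformLaw {u | u ≤ c} = ENNReal.ofReal c := by
  have : {u : ℝ | u ≤ c} ∩ Set.Icc 0 1 = Set.Icc 0 c := by
    ext u
    simp only [Set.mem_inter_iff, Set.mem_ofPred_eq, Set.mem_Icc]
    constructor
    · rintro ⟨h, h', -⟩; exact ⟨h', h⟩
    · rintro ⟨h, h'⟩; exact ⟨h', h, h'.trans h1⟩
  have hm : MeasurableSet {u : ℝ | u ≤ c} := measurableSet_Iic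
  rw [uniformLaw, Measure.restrict_apply hm, this, Real.volume_Icc, sub_zero]

/-- The law of an independent uniform variable for every unordered pair. -/
noncomputable def uniformPi (ι : Type*) [Fintype ι] : Measure (ι → ℝ) :=
  Measure.pi fun _ => uniformLaw

instance (ι : Type*) [Fintype ι] : IsProbabilityMeasure (uniformPi ι) := by
  unfold uniformPi; infer_instance

lemma uniformPi_eval_le {ι : Type*} [Fintype ι] (e : ι) {c : ℝ} (h1 : c ≤ 1) :
    uniformPi ι {u | u e ≤ c} = ENNReal.ofReal c := by
  rw [← uniformLaw_le h1]
  exact (measurePreserving_eval (fun _ : ι => uniformLaw) e).measure_preimage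
    measurableSet_Iic.nullMeasurableSet

lemma integral_uniformPi_eval {ι : Type*} [Fintype ι] (e : ι) {f : ℝ → ℝ} (hf : Measurable f) :
    ∫ u, f (u e) ∂(uniformPi ι) = ∫ x, f x ∂uniformLaw := by
  rw [← (measurePreserving_eval (fun _ : ι => uniformLaw) e).map_eq,
    integral_map (measurable_pi_apply e).aemeasurable hf.aestronglyMeasurable]
  rfl

/-- The centred and scaled indicator of the event that a uniform variable is at most `c`. -/
noncomputable def centredIndicator (c L x : ℝ) : ℝ := ((if x ≤ c then 1 else 0) - c) * L

lemma measurable_centredIndicator (c L : ℝ) : Measurable (centredIndicator c L) :=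
  ((Measurable.ite measurableSet_Iic measurable_const measurable_const).sub_const c).mul_const L

lemma abs_centredIndicator_le {c L : ℝ} (h0 : 0 ≤ c) (h1 : c ≤ 1) (hL : 0 ≤ L) (x : ℝ) :
    |centredIndicator c L x| ≤ L := by
  rw [centredIndicator, abs_mul, abs_of_nonneg hL]
  refine mul_le_of_le_one_left hL ?_
  split_ifs <;> rw [abs_le] <;> constructor <;> linarith

lemma integral_ite_uniformLaw {c : ℝ} (h0 : 0 ≤ c) (h1 : c ≤ 1) (a b : ℝ) :
    ∫ x, (if x ≤ c then a else b) ∂uniformLaw = c * a + (1 - c) * b := by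
  have h : ∀ x : ℝ, (if x ≤ c then a else b) =
      (Set.Iic c).indicator (fun _ => a - b) x + b := fun x => by
    by_cases hx : x ≤ c <;> simp [hx]
  simp only [h]
  rw [integral_add ((integrable_const _).indicator measurableSet_Iic) (integrable_const _),
    integral_indicator_const _ measurableSet_Iic, integral_const]
  have : uniformLaw.real (Set.Iic c) = c := by
    rw [Measure.real]
    exact (congrArg ENNReal.toReal (uniformLaw_le h1)).trans (ENNReal.toReal_ofReal h0)
  rw [this]
  simp
  ring

lemma integral_centredIndicator {c : ℝ} (h0 : 0 ≤ c) (h1 : c ≤ 1) (L : ℝ) :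
    ∫ x, centredIndicator c L x ∂uniformLaw = 0 := by
  have h : ∀ x, centredIndicator c L x = if x ≤ c then (1 - c) * L else -c * L := fun x => by
    rw [centredIndicator]; split_ifs <;> ring
  simp only [h]
  rw [integral_ite_uniformLaw h0 h1]
  ring

lemma integral_centredIndicator_sq {c : ℝ} (h0 : 0 ≤ c) (h1 : c ≤ 1) (L : ℝ) :
    ∫ x, centredIndicator c L x ^ 2 ∂uniformLaw = c * (1 - c) * L ^ 2 := by
  have h : ∀ x, centredIndicator c L x ^ 2 =
      if x ≤ c then ((1 - c) * L) ^ 2 else (-c * L) ^ 2 := fun x => by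
    rw [centredIndicator]; split_ifs <;> ring
  simp only [h]
  rw [integral_ite_uniformLaw h0 h1]
  ring

/-- Centred Bernoulli variables generated from independent uniform variables, switched off outside
a set `s` of indices. -/
lemma isNoise_centredIndicator {ι : Type*} [Fintype ι] {c : ι → ℝ} {s : ι → Prop}
    [DecidablePred s] {L : ℝ} (h0 : ∀ e, 0 ≤ c e) (h1 : ∀ e, c e ≤ 1) (hL : 0 ≤ L)
    (hvar : ∀ e, c e * (1 - c e) * L ^ 2 ≤ 4) :
    IsNoise (uniformPi ι) L
      (fun e u => if s e then centredIndicator (c e) L (u e) else 0) := by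
  set f : ι → ℝ → ℝ := fun e x => if s e then centredIndicator (c e) L x else 0 with hf
  have hmeas : ∀ e, Measurable (f e) := fun e => by
    by_cases h : s e
    · simpa [hf, h] using measurable_centredIndicator (c e) L
    · simp [hf, h]
  refine ⟨iIndepFun_pi (X := f) fun e => (hmeas e).aemeasurable,
    fun e => (hmeas e).comp (measurable_pi_apply e), fun e u => ?_, fun e => ?_, fun e => ?_⟩
  · split_ifs
    · exact abs_centredIndicator_le (h0 e) (h1 e) hL _
    · simpa using hL
  · refine (integral_uniformPi_eval e (hmeas e)).trans ?_
    by_cases h : s e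
    · simpa [hf, h] using integral_centredIndicator (h0 e) (h1 e) L
    · simp [hf, h]
  · refine (integral_uniformPi_eval e ((hmeas e).pow_const 2)).trans_le ?_
    by_cases h : s e
    · simpa [hf, h] using (integral_centredIndicator_sq (h0 e) (h1 e) L).trans_le (hvar e)
    · simp [hf, h]

end Coupling

/-! ### Recovery of the clusters -/

section Recovery

open Matrix

variable {n r K : ℕ} {C : Fin r → Finset (Fin n)}

/-- Both endpoints of the unordered pair `e` lie in a common cluster. -/
def InCluster (C : Fin r → Finset (Fin n)) (e : Sym2 (Fin n)) : Prop := ∃ k, ∀ i ∈ e, i ∈ C k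

lemma inCluster_mk {i j : Fin n} : InCluster C s(i, j) ↔ SameCluster C i j := by
  simp [InCluster, SameCluster]

open Classical in
/-- The extremal edge probabilities: `p` within clusters and `q` elsewhere. -/
noncomputable def extremalProb (C : Fin r → Finset (Fin n)) (p q : ℝ) (e : Sym2 (Fin n)) : ℝ :=
  if InCluster C e then p else q

open Classical in
/-- The noise of the extremal blockmodel. The diagonal entries of the data matrix are deterministic
and carry no noise. -/
noncomputable def blockNoise (C : Fin r → Finset (Fin n)) (p q L : ℝ) (e : Sym2 (Fin n))
    (u : Sym2 (Fin n) → ℝ) : ℝ :=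
  if ¬ e.IsDiag then centredIndicator (extremalProb C p q e) L (u e) else 0

/-- The graph on `Fin n` in which a pair is joined when its uniform variable does not exceed the
edge probability given by `P`. -/
def thresholdGraph (P : Fin n → Fin n → ℝ) (hP : ∀ i j, P i j = P j i)
    (u : Sym2 (Fin n) → ℝ) : SimpleGraph (Fin n) where
  Adj i j := i ≠ j ∧ u s(i, j) ≤ P i j
  symm := ⟨fun i j h => ⟨h.1.symm, by rw [Sym2.eq_swap, hP]; exact h.2⟩⟩
  loopless := ⟨fun i h => h.1 rfl⟩

lemma adjacencyMatrix_eq_zero_or_one (G : SimpleGraph (Fin n)) (i j : Fin n) :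
    adjacencyMatrix G i j = 0 ∨ adjacencyMatrix G i j = 1 := by
  classical
  simp only [adjacencyMatrix, of_apply]
  split_ifs <;> simp

lemma weightMatrix_eq {t : ℝ} (ht0 : 0 < t) (ht1 : t < 1) (A : Matrix (Fin n) (Fin n) ℝ)
    (i j : Fin n) : weightMatrix A t i j = (A i j - t) * (√(t * (1 - t)))⁻¹ := by
  have h1 : 0 < 1 - t := by linarith
  have hs : 0 < √(t * (1 - t)) := Real.sqrt_pos.2 (by positivity)
  have hss : √(t * (1 - t)) ^ 2 = t * (1 - t) := Real.sq_sqrt (by positivity)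
  have e1 : √((1 - t) / t) = (1 - t) * (√(t * (1 - t)))⁻¹ := by
    rw [Real.sqrt_eq_iff_mul_self_eq (by positivity) (by positivity)]
    field_simp
    rw [hss]
  have e2 : √(t / (1 - t)) = t * (√(t * (1 - t)))⁻¹ := by
    rw [Real.sqrt_eq_iff_mul_self_eq (by positivity) (by positivity)]
    field_simp
    rw [hss]
  rw [weightMatrix, of_apply, e1, e2]
  ring

/-- On the event that the noise has small spectral norm and small cluster averages, the clusters are
recovered from any threshold graph whose edge probabilities lie on the favourable side of the
extremal ones. -/
lemma isUniqueOptimum_thresholdGraph (hC : Pairwise (Function.onFun Disjoint C)) (hK1 : 1 ≤ K)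
    (hK : ∀ k, K ≤ (C k).card) (hn : 0 < n) {p q t : ℝ} (hq : 0 ≤ q) (hqp : q < p) (hp : p ≤ 1)
    (ht1 : p / 4 + 3 * q / 4 ≤ t) (ht2 : t ≤ 3 * p / 4 + q / 4)
    {P : Fin n → Fin n → ℝ} (hP : ∀ i j, P i j = P j i)
    (hin : ∀ i j, i ≠ j → SameCluster C i j → p ≤ P i j)
    (hout : ∀ i j, i ≠ j → ¬ SameCluster C i j → P i j ≤ q)
    {L δ : ℝ} (hL : L = (√(t * (1 - t)))⁻¹) (hδ : δ = (p - q) * L / 4)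
    (hLn : L ≤ 8 * √(n : ℝ)) (hKδ : 48 * √(n : ℝ) / K ≤ δ / 4) {u : Sym2 (Fin n) → ℝ}
    (hnorm : ∀ x, ‖toEuclideanLin (noiseMatrix (blockNoise C p q L) u) x‖ ≤
      40 * √(n : ℝ) * ‖x‖)
    (havg : ∀ i j, SameCluster C i i →
      |∑ l ∈ clusterOf C i, blockNoise C p q L s(l, j) u| ≤ (clusterOf C i).card * (δ / 6)) :
    IsUniqueOptimum (adjacencyMatrix (thresholdGraph P hP u)) t (clusterMatrix C) := by
  classical
  have ht0' : 0 < t := by linarith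
  have ht1' : t < 1 := by linarith
  have hL0 : 0 < L := by
    rw [hL]
    have : 0 < t * (1 - t) := mul_pos ht0' (by linarith)
    positivity
  have hδ0 : 0 < δ := by
    rw [hδ]
    have := mul_pos (sub_pos.2 hqp) hL0
    linarith
  have hadj : ∀ i j, adjacencyMatrix (thresholdGraph P hP u) i j =
      if i = j ∨ u s(i, j) ≤ P i j then 1 else 0 := fun i j => by
    by_cases h : i = j <;> simp [adjacencyMatrix, thresholdGraph, h]
  have hN : ∀ i j, noiseMatrix (blockNoise C p q L) u i j = if i = j then 0 else
      ((if u s(i, j) ≤ extremalProb C p q s(i, j) then 1 else 0) -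
        extremalProb C p q s(i, j)) * L := fun i j => by
    by_cases h : i = j <;> simp [noiseMatrix, blockNoise, centredIndicator, h]
  refine isUniqueOptimum_of_noise_bounds hC hK1 hK (adjacencyMatrix_eq_zero_or_one _)
    (N := noiseMatrix (blockNoise C p q L) u) ?_ hn hδ0 hL0.le (fun i j h => ?_) (fun i j h => ?_)
    hnorm hLn havg hKδ
  · have := (noiseMatrix_isHermitian (blockNoise C p q L) u).eq
    rwa [conjTranspose_eq_transpose_of_trivial] at this
  · rw [weightMatrix_eq ht0' ht1', ← hL, hadj, hN, hδ]
    by_cases hij : i = j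
    · rw [if_pos hij, if_pos (Or.inl hij)]
      nlinarith
    · have hpr : extremalProb C p q s(i, j) = p := if_pos (inCluster_mk.2 h)
      rw [if_neg hij, hpr]
      have hle := hin i j hij h
      have : (if u s(i, j) ≤ p then (1 : ℝ) else 0) ≤
          if i = j ∨ u s(i, j) ≤ P i j then 1 else 0 := by
        by_cases h1 : u s(i, j) ≤ p
        · rw [if_pos h1, if_pos (Or.inr (h1.trans hle))]
        · rw [if_neg h1]; split_ifs <;> norm_num
      nlinarith
  · rw [weightMatrix_eq ht0' ht1', ← hL, hadj, hN, hδ]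
    by_cases hij : i = j
    · rw [if_pos hij, if_pos (Or.inl hij), if_pos hij]
      nlinarith
    · have hpr : extremalProb C p q s(i, j) = q := if_neg fun h' => h (inCluster_mk.1 h')
      rw [if_neg hij, hpr, if_neg hij]
      have hle := hout i j hij h
      have : (if i = j ∨ u s(i, j) ≤ P i j then (1 : ℝ) else 0) ≤
          if u s(i, j) ≤ q then 1 else 0 := by
        by_cases h1 : u s(i, j) ≤ q
        · rw [if_pos h1]; split_ifs <;> norm_num
        · rw [if_neg h1, if_neg]
          rintro (h2 | h2)
          · exact hij h2
          · exact h1 (h2.trans hle)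
      nlinarith

/-- The law of the blockmodel graph is that of a threshold graph. -/
lemma IsGSBM.measureReal_eq {Ω : Type*} [MeasurableSpace Ω] {μ : Measure Ω}
    [IsProbabilityMeasure μ] {p q : ℝ} {G : Ω → SimpleGraph (Fin n)} (h : IsGSBM μ C K p q G)
    (hP : ∀ i j, μ.real {ω | (G ω).Adj i j} = μ.real {ω | (G ω).Adj j i})
    (T : Set (SimpleGraph (Fin n))) :
    μ.real {ω | G ω ∈ T} = (uniformPi (Sym2 (Fin n))).real
      {u | thresholdGraph (fun i j => μ.real {ω | (G ω).Adj i j}) hP u ∈ T} := by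
  -- the graph with prescribed edges
  set F : ({e : Fin n × Fin n // e.1 < e.2} → Prop) → SimpleGraph (Fin n) := fun x =>
    SimpleGraph.fromRel fun i j => ∃ hij : i < j, x ⟨(i, j), hij⟩ with hF
  have hF1 : ∀ H : SimpleGraph (Fin n), F (fun e => H.Adj e.1.1 e.1.2) = H := fun H => by
    ext i j
    simp only [hF, SimpleGraph.fromRel_adj]
    constructor
    · rintro ⟨-, ⟨-, h⟩ | ⟨-, h⟩⟩
      exacts [h, h.symm]
    · intro h
      refine ⟨h.ne, ?_⟩
      rcases lt_or_gt_of_ne h.ne with hlt | hlt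
      · exact Or.inl ⟨hlt, h⟩
      · exact Or.inr ⟨hlt, h.symm⟩
  have hinj : Function.Injective
      fun e : {e : Fin n × Fin n // e.1 < e.2} => s(e.1.1, e.1.2) := by
    rintro ⟨⟨a, b⟩, hab⟩ ⟨⟨c, d⟩, hcd⟩ he
    rcases Sym2.eq_iff.1 he with ⟨h1, h2⟩ | ⟨h1, h2⟩
    · exact Subtype.ext (Prod.ext h1 h2)
    · simp only at h1 h2 hab hcd
      subst h1 h2
      exact absurd hab hcd.not_gt
  set X' : {e : Fin n × Fin n // e.1 < e.2} → (Sym2 (Fin n) → ℝ) → Prop := fun e u =>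
    u s(e.1.1, e.1.2) ≤ μ.real {ω | (G ω).Adj e.1.1 e.1.2} with hX'
  have hX'm : ∀ e, Measurable (X' e) := fun e =>
    measurableSet_setOfPred.1 (measurableSet_le (measurable_pi_apply _) measurable_const)
  have hi' : iIndepFun X' (uniformPi (Sym2 (Fin n))) := by
    have h1 : iIndepFun (fun (e : Sym2 (Fin n)) (u : Sym2 (Fin n) → ℝ) => u e)
        (uniformPi (Sym2 (Fin n))) :=
      iIndepFun_pi (X := fun (_ : Sym2 (Fin n)) (x : ℝ) => x) fun _ => aemeasurable_id
    exact (h1.precomp hinj).comp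
      (fun e (x : ℝ) => x ≤ μ.real {ω | (G ω).Adj e.1.1 e.1.2})
      fun e => measurableSet_setOfPred.1 measurableSet_Iic
  have key := measureReal_eq_of_iIndepFun
    (X := fun (e : {e : Fin n × Fin n // e.1 < e.2}) ω => (G ω).Adj e.1.1 e.1.2) (X' := X')
    (fun e => measurableSet_setOfPred.1 (h.measurable _ _)) hX'm
    (iIndepSet.iIndepFun_mem h.indep) hi'
    (fun e => by
      rw [hX', uniformPi_eval_le _ measureReal_le_one, Measure.real,
        ENNReal.ofReal_toReal (measure_ne_top _ _)])
    (F ⁻¹' T)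
  simp only [Set.mem_preimage, hF1] at key
  rw [key]
  congr 1
  ext u
  have : (fun e => X' e u) = fun e : {e : Fin n × Fin n // e.1 < e.2} =>
      (thresholdGraph (fun i j => μ.real {ω | (G ω).Adj i j}) hP u).Adj e.1.1 e.1.2 := by
    funext e
    simp [hX', thresholdGraph, e.2.ne]
  simp only [Set.mem_ofPred_eq]
  rw [this, hF1]

/-- The noise fails to be well behaved with probability at most `3 / n ^ 8`. -/
lemma measureReal_bad_le (hK : ∀ k, K ≤ (C k).card) (hn : 3 ≤ n) {p q L δ Λ : ℝ} {k : ℕ}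
    (hnoise : IsNoise (uniformPi (Sym2 (Fin n))) L (blockNoise C p q L)) (hδ : 0 ≤ δ)
    (hδL : δ * L ≤ 4) (hδK : 10 * Real.log n ≤ K * (δ / 6) ^ 2 / 16)
    (hLΛ : L ≤ Λ) (hΛ : 2 ≤ Λ) (hk : 45 * Real.log n ≤ k) (hΛk : Λ ^ 2 * (6 * k) = 4 * n) :
    (uniformPi (Sym2 (Fin n))).real
      {u | ¬ ((∀ x, ‖toEuclideanLin (noiseMatrix (blockNoise C p q L) u) x‖ ≤
          40 * √(n : ℝ) * ‖x‖) ∧ ∀ i j, SameCluster C i i →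
        |∑ l ∈ clusterOf C i, blockNoise C p q L s(l, j) u| ≤
          (clusterOf C i).card * (δ / 6))} ≤ 3 / (n : ℝ) ^ 8 := by
  have hn0 : (0 : ℝ) < n := by exact_mod_cast (by omega : 0 < n)
  have hlog : 0 < Real.log n := Real.log_pos (by exact_mod_cast (by omega : 1 < n))
  have hexp : ∀ a : ℕ, Real.exp (-(a * Real.log n)) = 1 / (n : ℝ) ^ a := fun a => by
    rw [Real.exp_neg, Real.exp_nat_mul, Real.exp_log hn0, one_div]
  set ν := uniformPi (Sym2 (Fin n)) with hν
  set bad₁ := {u | ¬ ∀ x, ‖toEuclideanLin (noiseMatrix (blockNoise C p q L) u) x‖ ≤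
    40 * √(n : ℝ) * ‖x‖} with hbad₁
  set bad₂ : Fin n × Fin n → Set (Sym2 (Fin n) → ℝ) := fun ij => {u | SameCluster C ij.1 ij.1 ∧
    (clusterOf C ij.1).card * (δ / 6) < |∑ l ∈ clusterOf C ij.1, blockNoise C p q L s(l, ij.2) u|}
    with hbad₂
  have hsub : {u | ¬ ((∀ x, ‖toEuclideanLin (noiseMatrix (blockNoise C p q L) u) x‖ ≤
          40 * √(n : ℝ) * ‖x‖) ∧ ∀ i j, SameCluster C i i →
        |∑ l ∈ clusterOf C i, blockNoise C p q L s(l, j) u| ≤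
          (clusterOf C i).card * (δ / 6))} ⊆ bad₁ ∪ ⋃ ij, bad₂ ij := by
    intro u hu
    by_cases h1 : u ∈ bad₁
    · exact Or.inl h1
    · right
      simp only [hbad₁, Set.mem_ofPred_eq, not_not] at h1
      simp only [Set.mem_ofPred_eq, not_and] at hu
      have := hu h1
      push Not at this
      obtain ⟨i, j, hs, hlt⟩ := this
      exact Set.mem_iUnion.2 ⟨(i, j), hs, hlt⟩
  have hk1 : 1 ≤ k := by
    have : (0 : ℝ) < k := by linarith
    exact_mod_cast this
  have h1 : ν.real bad₁ ≤ 1 / (n : ℝ) ^ 8 := by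
    refine (hnoise.measureReal_norm_gt_le hk1 (by omega) hLΛ hΛ hΛk).trans ?_
    have h2 : (13 / 20 : ℝ) ^ k ≤ 1 / (n : ℝ) ^ 9 := by
      have h3 : (13 / 20 : ℝ) ≤ Real.exp (-(1 / 5)) := by
        linarith [Real.add_one_le_exp (-(1 / 5 : ℝ))]
      calc (13 / 20 : ℝ) ^ k ≤ Real.exp (-(1 / 5)) ^ k := pow_le_pow_left₀ (by norm_num) h3 _
        _ = Real.exp (k * -(1 / 5)) := (Real.exp_nat_mul _ _).symm
        _ ≤ Real.exp (-((9 : ℕ) * Real.log n)) := Real.exp_le_exp.2 (by push_cast; linarith)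
        _ = _ := hexp 9
    refine (mul_le_mul_of_nonneg_left h2 hn0.le).trans (le_of_eq ?_)
    field_simp
  have h2 : ∀ ij, ν.real (bad₂ ij) ≤ 2 / (n : ℝ) ^ 10 := by
    rintro ⟨i, j⟩
    by_cases hs : SameCluster C i i
    · have hnoise' : IsNoise ν L fun l : Fin n => blockNoise C p q L s(l, j) := by
        refine ⟨hnoise.indep.precomp (g := fun l : Fin n => s(l, j)) fun a b hab => ?_,
          fun _ => hnoise.measurable _, fun _ => hnoise.abs_le _,
          fun _ => hnoise.integral_eq_zero _, fun _ => hnoise.integral_sq_le _⟩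
        exact Sym2.congr_left.1 hab
      have h3 := hnoise'.measureReal_sum_ge_le (clusterOf C i) (η := δ / 6) (by positivity)
        (by linarith)
      have h4 : bad₂ (i, j) ⊆ {u | (clusterOf C i).card * (δ / 6) <
          |∑ l ∈ clusterOf C i, blockNoise C p q L s(l, j) u|} := fun u hu => hu.2
      refine (measureReal_mono h4).trans (h3.trans ?_)
      have h5 : Real.exp (-((clusterOf C i).card * (δ / 6) ^ 2 / 16)) ≤ 1 / (n : ℝ) ^ 10 := by
        rw [← hexp 10]
        refine Real.exp_le_exp.2 (neg_le_neg ?_)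
        have h6 : (K : ℝ) ≤ (clusterOf C i).card := by exact_mod_cast le_card_clusterOf hK hs
        have h7 := mul_le_mul_of_nonneg_right h6 (sq_nonneg (δ / 6))
        push_cast
        linarith
      calc 2 * Real.exp (-((clusterOf C i).card * (δ / 6) ^ 2 / 16)) ≤ 2 * (1 / (n : ℝ) ^ 10) := by
            linarith
        _ = _ := by ring
    · have : bad₂ (i, j) = ∅ := Set.eq_empty_of_forall_notMem fun u hu => hs hu.1
      rw [this, measureReal_empty]
      positivity
  have h3 : ν.real (⋃ ij, bad₂ ij) ≤ 2 / (n : ℝ) ^ 8 := by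
    refine (measureReal_iUnion_fintype_le _).trans ((Finset.sum_le_sum fun ij _ => h2 ij).trans
      (le_of_eq ?_))
    rw [Finset.sum_const, Finset.card_univ, Fintype.card_prod, Fintype.card_fin, nsmul_eq_mul]
    push_cast
    field_simp
  calc _ ≤ ν.real (bad₁ ∪ ⋃ ij, bad₂ ij) := measureReal_mono hsub
    _ ≤ ν.real bad₁ + ν.real (⋃ ij, bad₂ ij) := measureReal_union_le _ _
    _ ≤ 1 / (n : ℝ) ^ 8 + 2 / (n : ℝ) ^ 8 := add_le_add h1 h3
    _ = _ := by ring

/-- The variances of the two extremal edge laws, compared with that of a Bernoulli variable with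
parameter `t`. -/
lemma variance_le {p q t : ℝ} (hq : 0 ≤ q) (hqp : q < p) (hp : p ≤ 1)
    (ht1 : p / 4 + 3 * q / 4 ≤ t) (ht2 : t ≤ 3 * p / 4 + q / 4) :
    p * (1 - p) ≤ 4 * (t * (1 - t)) ∧ q * (1 - q) ≤ 4 * (t * (1 - t)) := by
  constructor
  · have := mul_le_mul (by linarith : p ≤ 4 * t) (by linarith : 1 - p ≤ 1 - t) (by linarith)
      (by linarith)
    linarith
  · have := mul_le_mul (by linarith : q ≤ t) (by linarith : 1 - q ≤ 4 * (1 - t)) (by linarith)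
      (by linarith)
    linarith

/-- The half-length `k` of the walks is chosen of order `log n`, and the bound `Λ` on the entries is
the smallest one that the comparison with walks on `8 k` vertices allows. -/
lemma exists_walk_length {ℓ L : ℝ} (hℓ : 1 ≤ ℓ) (hL2 : 2 ≤ L)
    (hLn : L ^ 2 * (36864 * ℓ ^ 4) ≤ n) :
    ∃ (k : ℕ) (Λ : ℝ), L ≤ Λ ∧ 2 ≤ Λ ∧ 45 * ℓ ≤ k ∧ Λ ^ 2 * (6 * k) = 4 * n := by
  have hℓ4 : ℓ ≤ ℓ ^ 4 := le_self_pow₀ hℓ (by norm_num)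
  set k := ⌈45 * ℓ⌉₊ with hk
  have hk1 : 45 * ℓ ≤ k := Nat.le_ceil _
  have hk2 : (k : ℝ) ≤ 46 * ℓ := by
    have := Nat.ceil_lt_add_one (by positivity : 0 ≤ 45 * ℓ)
    linarith
  have hk0 : (0 : ℝ) < k := by linarith
  have hLΛ : L ≤ √(4 * n / (6 * k)) := by
    refine Real.le_sqrt_of_sq_le ?_
    rw [le_div_iff₀ (by positivity)]
    have h1 : L ^ 2 * (6 * k) ≤ L ^ 2 * (36864 * ℓ ^ 4) :=
      mul_le_mul_of_nonneg_left (by linarith) (sq_nonneg _)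
    have : (0 : ℝ) ≤ n := Nat.cast_nonneg n
    linarith
  refine ⟨k, √(4 * n / (6 * k)), hLΛ, hL2.trans hLΛ, hk1, ?_⟩
  rw [Real.sq_sqrt (by positivity)]
  field_simp

/-- The numerical consequences of the separation of `p` and `q`. -/
lemma exists_parameters (hn : 3 ≤ n) (hK1 : 1 ≤ K) (hKn : K ≤ n) {p q t : ℝ} (hq : 0 ≤ q)
    (hqp : q < p) (hp : p ≤ 1)
    (ht1 : p / 4 + 3 * q / 4 ≤ t) (ht2 : t ≤ 3 * p / 4 + q / 4)
    (hsep : (p - q) / √(p * (1 - q)) ≥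
      768 * max (√(n : ℝ) / (K : ℝ)) ((Real.log n) ^ 2 / √(K : ℝ)))
    {L δ : ℝ} (hL : L = (√(t * (1 - t)))⁻¹) (hδ : δ = (p - q) * L / 4) :
    0 < L ∧ 0 ≤ δ ∧ L ≤ 8 * √(n : ℝ) ∧ 48 * √(n : ℝ) / K ≤ δ / 4 ∧ δ * L ≤ 4 ∧
      10 * Real.log n ≤ K * (δ / 6) ^ 2 / 16 ∧ p * (1 - p) * L ^ 2 ≤ 4 ∧
      q * (1 - q) * L ^ 2 ≤ 4 ∧
      ∃ (k : ℕ) (Λ : ℝ), L ≤ Λ ∧ 2 ≤ Λ ∧ 45 * Real.log n ≤ k ∧ Λ ^ 2 * (6 * k) = 4 * n := by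
  have hK0 : (0 : ℝ) < K := by exact_mod_cast hK1
  have hn0 : (0 : ℝ) < n := by exact_mod_cast (by omega : 0 < n)
  have hKn' : (K : ℝ) ≤ n := by exact_mod_cast hKn
  have hlog : 1 ≤ Real.log n := by
    rw [Real.le_log_iff_exp_le hn0]
    have : (3 : ℝ) ≤ n := by exact_mod_cast hn
    linarith [Real.exp_one_lt_d9]
  set ℓ := Real.log n with hℓ
  set D := p * (1 - q) with hD
  have hpq : p - q ≤ D := by rw [hD]; nlinarith only [mul_nonneg hq (sub_nonneg.2 hp)]
  have hD0 : 0 < D := by linarith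
  have ht0 : 0 < t := by linarith
  have h1t : 0 < 1 - t := by linarith
  set v := t * (1 - t) with hv
  have hv0 : 0 < v := mul_pos ht0 h1t
  have hvD : v ≤ D := by
    rw [hv, hD]; exact mul_le_mul (by linarith) (by linarith) h1t.le (by linarith)
  have hDv : D ≤ 16 * v := by
    have h1 : p ≤ 4 * t := by linarith
    have h2 : 1 - q ≤ 4 * (1 - t) := by linarith
    have := mul_le_mul h1 h2 (by linarith) (by linarith)
    rw [hv, hD]; linarith
  have hL0 : 0 < L := by rw [hL]; positivity
  have hL2 : L ^ 2 = v⁻¹ := by rw [hL, inv_pow, Real.sq_sqrt hv0.le]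
  have hLv : L ^ 2 * v = 1 := by rw [hL2, inv_mul_cancel₀ hv0.ne']
  set g := (p - q) / √D with hg
  have hsD : 0 < √D := Real.sqrt_pos.2 hD0
  have hsD2 : √D ^ 2 = D := Real.sq_sqrt hD0.le
  have hg1 : 768 * (√(n : ℝ) / K) ≤ g :=
    (mul_le_mul_of_nonneg_left (le_max_left _ _) (by norm_num)).trans hsep
  have hg2 : 768 * (ℓ ^ 2 / √(K : ℝ)) ≤ g :=
    (mul_le_mul_of_nonneg_left (le_max_right _ _) (by norm_num)).trans hsep
  have hg0 : 0 ≤ g := le_trans (by positivity) hg2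
  have hδg : g / 4 ≤ δ := by
    rw [hδ, hg, hL, div_eq_mul_inv (p - q)]
    have : (√D)⁻¹ ≤ (√v)⁻¹ := inv_anti₀ (Real.sqrt_pos.2 hv0) (Real.sqrt_le_sqrt hvD)
    have := mul_le_mul_of_nonneg_left this (sub_pos.2 hqp).le
    linarith
  have hδ0 : 0 ≤ δ := le_trans (by positivity) hδg
  have hgD : g ≤ √D := by
    rw [hg, div_le_iff₀ hsD]; linarith only [hpq, hsD2]
  have hg3 : 768 ^ 2 * ℓ ^ 4 / K ≤ g ^ 2 := by
    have h1 := pow_le_pow_left₀ (by positivity) hg2 2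
    have h2 : (768 * (ℓ ^ 2 / √(K : ℝ))) ^ 2 = 768 ^ 2 * ℓ ^ 4 / K := by
      rw [mul_pow, div_pow, Real.sq_sqrt hK0.le]; ring
    rwa [h2] at h1
  -- `L ^ 2` is at most `n / (192 ^ 2 log ^ 4 n)`
  have hLn : L ^ 2 * (36864 * ℓ ^ 4) ≤ n := by
    have h1 : g ^ 2 ≤ D := by rw [← hsD2]; exact pow_le_pow_left₀ hg0 hgD 2
    have h2 : 768 ^ 2 * ℓ ^ 4 ≤ D * K := by
      rw [← div_le_iff₀ hK0]; exact hg3.trans h1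
    have h3 : D * K ≤ 16 * v * n := mul_le_mul hDv hKn' hK0.le (by positivity)
    have h4 : 36864 * ℓ ^ 4 ≤ v * n := by linarith
    calc L ^ 2 * (36864 * ℓ ^ 4) ≤ L ^ 2 * (v * n) := mul_le_mul_of_nonneg_left h4 (sq_nonneg _)
      _ = n := by rw [← mul_assoc, hLv, one_mul]
  have hℓ4 : ℓ ≤ ℓ ^ 4 := le_self_pow₀ hlog (by norm_num)
  have hL2' : 2 ≤ L := by
    have h1 : v ≤ 1 / 4 := by rw [hv]; nlinarith only [sq_nonneg (t - 1 / 2)]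
    have h2 := mul_le_mul_of_nonneg_left h1 (sq_nonneg L)
    exact (sq_le_sq₀ (by norm_num) hL0.le).1 (by linarith only [h2, hLv])
  refine ⟨hL0, hδ0, ?_, ?_, ?_, ?_, ?_, ?_, ?_⟩
  · have h1 : L ^ 2 ≤ n := by
      have h0 : 1 ≤ 36864 * ℓ ^ 4 := by linarith only [hℓ4, hlog]
      linarith only [mul_le_mul_of_nonneg_left h0 (sq_nonneg L), hLn]
    have h2 : L ≤ √(n : ℝ) := Real.le_sqrt_of_sq_le h1
    linarith [Real.sqrt_nonneg (n : ℝ)]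
  · rw [mul_div_assoc]; linarith
  · rw [hδ, show (p - q) * L / 4 * L = (p - q) * L ^ 2 / 4 by ring]
    have h1 : (p - q) * L ^ 2 ≤ 16 * v * L ^ 2 :=
      mul_le_mul_of_nonneg_right (hpq.trans hDv) (sq_nonneg _)
    linarith
  · have h1 : (g / 4) ^ 2 ≤ δ ^ 2 := pow_le_pow_left₀ (by positivity) hδg 2
    have h2 : 768 ^ 2 * ℓ ^ 4 ≤ g ^ 2 * K := by rwa [div_le_iff₀ hK0] at hg3
    have h3 := mul_le_mul_of_nonneg_right h1 hK0.le
    have h4 : K * (δ / 6) ^ 2 / 16 = δ ^ 2 * K / 576 := by ring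
    rw [h4]
    linarith
  · have := mul_le_mul_of_nonneg_right (variance_le hq hqp hp ht1 ht2).1 (sq_nonneg L)
    linarith only [this, hLv]
  · have := mul_le_mul_of_nonneg_right (variance_le hq hqp hp ht1 ht2).2 (sq_nonneg L)
    linarith only [this, hLv]
  · exact exists_walk_length hlog hL2' hLn

end Recovery

theorem theorem1 :
    ∃ c₀ c₁ : ℝ, 0 < c₀ ∧ 0 < c₁ ∧
      ∀ (Ω : Type*) [MeasurableSpace Ω] (μ : Measure Ω) [IsProbabilityMeasure μ]
        (n r K : ℕ) (C : Fin r → Finset (Fin n)) (p q t : ℝ) (G : Ω → SimpleGraph (Fin n)),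
        0 ≤ q → q < p → p ≤ 1 →
        IsGSBM μ C K p q G →
        p / 4 + 3 * q / 4 ≤ t → t ≤ 3 * p / 4 + q / 4 →
        (p - q) / √(p * (1 - q)) ≥
          c₁ * max (√(n : ℝ) / (K : ℝ)) ((Real.log n) ^ 2 / √(K : ℝ)) →
        1 - c₀ / (n : ℝ) ^ 8 ≤
          μ.real {ω | IsUniqueOptimum (adjacencyMatrix (G ω)) t (clusterMatrix C)} := by
  classical
  -- `256 = 2 ^ 8` makes the claim void for `n ≤ 2`; `768 = 4 * 4 * 48` gives
  -- `48 √n / K ≤ δ / 4`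
  refine ⟨256, 768, by norm_num, by norm_num, ?_⟩
  intro Ω _ μ _ n r K C p q t G hq hqp hp hG ht1 ht2 hsep
  have hKn : K ≤ n := by
    have h := (hG.K_le ⟨0, hG.one_le_r⟩).trans (Finset.card_le_univ _)
    rwa [Fintype.card_fin] at h
  have hK1 := hG.K_pos
  rcases Nat.lt_or_ge n 3 with hn | hn
  · have hn1 : (0 : ℝ) < n := by exact_mod_cast hK1.trans hKn
    have hn2 : (n : ℝ) ^ 8 ≤ 2 ^ 8 :=
      pow_le_pow_left₀ hn1.le (by exact_mod_cast Nat.lt_succ_iff.1 hn) 8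
    have : 1 ≤ 256 / (n : ℝ) ^ 8 := by
      rw [le_div_iff₀ (by positivity)]; linarith
    exact le_trans (by linarith) measureReal_nonneg
  set L := (√(t * (1 - t)))⁻¹ with hL
  set δ := (p - q) * L / 4 with hδ
  obtain ⟨hL0, hδ0, hLn, hKδ, hδL, hδK, hvp, hvq, k, Λ, hLΛ, hΛ, hk, hΛk⟩ :=
    exists_parameters hn hK1 hKn hq hqp hp ht1 ht2 hsep hL hδ
  have hP : ∀ i j, μ.real {ω | (G ω).Adj i j} = μ.real {ω | (G ω).Adj j i} := fun i j => by
    simp only [SimpleGraph.adj_comm]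
  have hnoise : IsNoise (uniformPi (Sym2 (Fin n))) L (blockNoise C p q L) := by
    refine isNoise_centredIndicator (c := extremalProb C p q) (s := fun e => ¬ e.IsDiag)
      (fun e => ?_) (fun e => ?_) hL0.le (fun e => ?_) <;> unfold extremalProb <;> split_ifs <;>
      first | assumption | linarith
  have hbad := measureReal_bad_le hG.K_le hn hnoise hδ0 hδL hδK hLΛ hΛ hk hΛk
  rw [show {ω | IsUniqueOptimum (adjacencyMatrix (G ω)) t (clusterMatrix C)} =
    {ω | G ω ∈ {H | IsUniqueOptimum (adjacencyMatrix H) t (clusterMatrix C)}} from rfl,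
    hG.measureReal_eq hP]
  have hcover := measureReal_mono (μ := uniformPi (Sym2 (Fin n))) (s₁ := Set.univ)
    (s₂ := {u | thresholdGraph (fun i j => μ.real {ω | (G ω).Adj i j}) hP u ∈
      {H | IsUniqueOptimum (adjacencyMatrix H) t (clusterMatrix C)}} ∪
      {u | ¬ ((∀ x, ‖Matrix.toEuclideanLin (noiseMatrix (blockNoise C p q L) u) x‖ ≤
          40 * √(n : ℝ) * ‖x‖) ∧ ∀ i j, SameCluster C i i →
        |∑ l ∈ clusterOf C i, blockNoise C p q L s(l, j) u| ≤
          (clusterOf C i).card * (δ / 6))}) fun u _ => by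
    rw [Set.mem_union]
    refine or_iff_not_imp_right.2 fun hu => ?_
    rw [Set.mem_ofPred_eq, not_not] at hu
    exact isUniqueOptimum_thresholdGraph hG.disjoint hK1 hG.K_le (by omega) hq hqp hp ht1 ht2 hP
      hG.le_prob hG.prob_le hL hδ hLn hKδ hu.1 hu.2
  have hunion := hcover.trans (measureReal_union_le _ _)
  rw [probReal_univ] at hunion
  have h256 : 3 / (n : ℝ) ^ 8 ≤ 256 / (n : ℝ) ^ 8 :=
    div_le_div_of_nonneg_right (by norm_num) (by positivity)
  linarith
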